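/- **Setting.** Let $M\ge 1$ be an integer, let $\log^* M$ be the least $k$ such that $k$ applications of $\log_2$ to $M$ give a value at most $1$, and put $\Delta_L=\log^*M+6$, $\Delta_R=4$. Let $f:[0..M]^{\log^*M+11}\to\{0,1\}$ be a locally consistent parsing function: for every sequence $p$ over $[1..M]$ of length $n\ge 2$ with $p[i]\ne p[i+1]$ for all $i$, the bits $d[i]=f(\tilde p[i-\Delta_L],\dots,\tilde p[i+\Delta_R])$ (where $\tilde p$ is $p$ extended by zeros) satisfy $d[1]=1$, $d[n]=0$, $d[i]+d[i+1]\le 1$ for $1\le i<n$, and $d[i]+d[i+1]+d[i+2]+d[i+3]\ge 1$ for $1\le i<n-3$. Let $\mathrm{Eblock}_d(p)$ be the decomposition of $p$ into blocks that begin exactly at the positions with $d[i]=1$, and let $\mathrm{Epow}(s)$ be the sequence of maximal runs $a^k$ of $s$. A run-length straight-line program $\mathcal G=(\Sigma,\mathcal V,\mathcal D,S)$ has a finite set $\mathcal V$ of positive integers as variables and exactly one assignment for each variable, of the form $X\to a$ with $a\in\Sigma$, $X\to X_\ell X_r$ or $X\to \hat X^k$ with $k\ge1$; it is acyclic, no two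 variables have the same right-hand side, and every variable occurs in the derivation tree of $S$. Let $\mathrm{val}(X)$ be the string derived by $X$. For a right-hand side $x$, $\mathrm{Sig}(x)$ is the variable to which $x$ is assigned; for blocks $x$ of three or four variables, $\mathrm{Sig}(x)=\mathrm{Sig}(\mathrm{Sig}(x[1..|x|-1])\,x[|x|])$; otherwise it is undefined. $\mathrm{Sig}^+$ applies $\mathrm{Sig}$ entrywise. For a non-empty string $T$ with $4|T|\le M$, $\mathcal G$ is the *signature encoding* of $T$ if $\mathcal V\subseteq[1..M]$ and, with $$\mathrm{Shrink}_0=\mathrm{Sig}^+(T),\quad \mathrm{Pow}_t=\mathrm{Sig}^+(\mathrm{Epow}(\mathrm{Shrink}_t)),\quad \mathrm{Shrink}_{t+1}=\mathrm{Sig}^+(\mathrm{Eblock}_d(\mathrm{Pow}_t)),$$ all signatures needed up to $\mathrm{Pow}_h$ are defined and $\mathrm{Pow}_h=S$, where $h$ is the least $t$ with $|\mathrm{Pow}_t|=1$. A node of a derivation tree has level $t$ if its signature is produced by $\mathrm{Shrink}_t$ or $\mathrm{Pow}_t$ (including the signatures of proper prefixes of blocks). For a string $P$ let $\mathrm{XShrink}_0=\mathrm{Sig}^+(P)$.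 Let $\mathrm{XPow}_t$ be $\mathrm{Sig}^+\circ\mathrm{Epow}$ of $\mathrm{XShrink}_t$ without its first run $\hat L_t$ and its last run $\hat R_t$. With $d$ the bit sequence of $\mathrm{XPow}_t$, let $L_t$ be its shortest prefix of length at least $\Delta_L$ with $d[|L_t|+1]=1$ and $R_t$ its shortest suffix of length at least $\Delta_R+1$ with $d[|d|-|R_t|+1]=1$; let $\mathrm{XShrink}_{t+1}$ be $\mathrm{Sig}^+$ of the blocks of $\mathrm{XPow}_t$ that lie between $L_t$ and $R_t$. Let $h^P$ be the least $t$ with $|\mathrm{Epow}(\mathrm{XShrink}_t)|\le\Delta_L+\Delta_R+9$. The *common sequence* of $P$ is $$\mathrm{Uniq}(P)=\hat L_0L_0\cdots\hat L_{h^P-1}L_{h^P-1}\,\mathrm{XShrink}_{h^P}\,R_{h^P-1}\hat R_{h^P-1}\cdots R_0\hat R_0 .$$ **Lemma.** There is an absolute constant $C>0$ such that the following holds for all $M$, $f$, all alphabets $\Sigma$, all non-empty strings $T$ with $4|T|\le M$ and every signature encoding $\mathcal G$ of $T$. Let $e\in\mathcal V$, let $\mathcal T$ be the derivation tree of $e$,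 let $s=\mathrm{val}(e)$, and let $P$ be a non-empty string with an occurrence in $s$. Then $\mathrm{Uniq}(P)$ is defined and the occurrence is represented by it in $\mathcal T$: $\mathrm{Uniq}(P)$ derives $P$, and each of its entries is the label of a node of $\mathcal T$ that derives the corresponding part of the occurrence. Let $X$ be the subtree of $\mathcal T$ induced by the paths from the root of $\mathcal T$ to the parents of the nodes representing $\mathrm{Uniq}(P)$. Then $X$ has at most $C\log^*M$ nodes in every level, and, if $|s|\ge 2$, at most $C\,(\log_2|s|+\log_2|P|\cdot\log^*M)$ nodes in total. -/

import Mathlib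

namespace SigEnc

/-! ### Locally consistent parsing -/

/-- The iterated logarithm `log* n`: the least number of applications of `log₂` to `n` after
which the value is at most `1`. -/
noncomputable def logStar (n : ℕ) : ℕ :=
  sInf {k : ℕ | (Real.logb 2)^[k] (n : ℝ) ≤ 1}

/-- `Δ_L = log* W + 6`. -/
noncomputable def deltaL (W : ℕ) : ℕ := logStar W + 6

/-- `Δ_R = 4`. -/
def deltaR : ℕ := 4

/-- The bit `d[i] = f(p̃[i - Δ_L], …, p̃[i + Δ_R])` of the sequence `p`, where `p̃` extends `p` by
zeros on both sides. Positions are counted from `0`. -/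
noncomputable def bit {W : ℕ} (f : (Fin (logStar W + 11) → ℕ) → Bool) (p : List ℕ) (i : ℕ) :
    Bool :=
  f fun j => if deltaL W ≤ i + j.val then p.getD (i + j.val - deltaL W) 0 else 0

/-- `f` is a locally consistent parsing function for `[0..W]`: on every sequence `p` over `[1..W]`
of length `n ≥ 2` without equal neighbours, its bit sequence `d` satisfies `d[1] = 1`, `d[n] = 0`,
`d[i] + d[i+1] ≤ 1` for `1 ≤ i < n`, and `d[i] + d[i+1] + d[i+2] + d[i+3] ≥ 1` for `1 ≤ i < n - 3`
(positions in this comment are counted from `1`, in the code from `0`). -/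
def IsLocallyConsistent (W : ℕ) (f : (Fin (logStar W + 11) → ℕ) → Bool) : Prop :=
  ∀ p : List ℕ, 2 ≤ p.length → (∀ x ∈ p, 1 ≤ x ∧ x ≤ W) → p.IsChain (· ≠ ·) →
    bit f p 0 = true ∧
    bit f p (p.length - 1) = false ∧
    (∀ i, i + 1 < p.length → ¬ (bit f p i = true ∧ bit f p (i + 1) = true)) ∧
    (∀ i, i + 4 < p.length →
      bit f p i = true ∨ bit f p (i + 1) = true ∨ bit f p (i + 2) = true ∨ bit f p (i + 3) = true)

/-- Each entry of `p` together with its bit. -/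
noncomputable def withBits {W : ℕ} (f : (Fin (logStar W + 11) → ℕ) → Bool) (p : List ℕ) :
    List (ℕ × Bool) :=
  p.zip ((List.range p.length).map (bit f p))

/-- Cut a sequence into blocks: a new block starts at the first entry and at every entry whose bit
is `1`. -/
def cut : List (ℕ × Bool) → List (List ℕ)
  | [] => []
  | [(x, _)] => [[x]]
  | (x, _) :: (y, b) :: l =>
    if b then [x] :: cut ((y, b) :: l)
    else match cut ((y, b) :: l) with
      | [] => [[x]]
      | q :: qs => (x :: q) :: qs

/-- `Eblock_d(p)`, with the bit sequence `d` that `f` gives for `p`. -/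
noncomputable def eblock {W : ℕ} (f : (Fin (logStar W + 11) → ℕ) → Bool) (p : List ℕ) :
    List (List ℕ) :=
  cut (withBits f p)

/-- `Epow(s)`: the maximal runs `a ^ k` of `s`, as pairs `(a, k)`. -/
def epow : List ℕ → List (ℕ × ℕ)
  | [] => []
  | a :: s =>
    match epow s with
    | [] => [(a, 1)]
    | (b, k) :: r => if a = b then (b, k + 1) :: r else (a, 1) :: (b, k) :: r

/-! ### Run-length straight-line programs and derivation trees -/

/-- The right-hand sides of assignments: a character `a`, a pair `X_ℓ X_r`, or a run `X ^ k`. -/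
inductive Rhs (α : Type*) where
  | char (a : α)
  | pair (l r : ℕ)
  | pow (x k : ℕ)

/-- The variables on the right-hand side, in order; `none` stands for "no assignment". -/
def childrenOf {α : Type*} : Option (Rhs α) → List ℕ
  | none => []
  | some (.char _) => []
  | some (.pair l r) => [l, r]
  | some (.pow x k) => List.replicate k x

/-- A run-length straight-line program. Variables are positive integers; `rhs X` is the right-hand
side assigned to `X`, and `rhs X = none` when `X` is not a variable. -/
structure RLSLP (α : Type*) where
  rhs : ℕ → Option (Rhs α)
  start : ℕ
  finite_vars : {X | rhs X ≠ none}.Finite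
  var_pos : ∀ X, rhs X ≠ none → 1 ≤ X
  start_var : rhs start ≠ none
  closed : ∀ X, ∀ Y ∈ childrenOf (rhs X), rhs Y ≠ none
  exponent_pos : ∀ X x k, rhs X = some (.pow x k) → 1 ≤ k
  acyclic : WellFounded fun Y X => Y ∈ childrenOf (rhs X)
  not_redundant : ∀ X Y, rhs X ≠ none → rhs X = rhs Y → X = Y
  not_useless : ∀ X, rhs X ≠ none →
    Relation.ReflTransGen (fun Y Z => Z ∈ childrenOf (rhs Y)) start X

namespace RLSLP

variable {α : Type*} (G : RLSLP α)

/-- The set `𝒱` of variables. -/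
def vars : Set ℕ := {X | G.rhs X ≠ none}

/-- The ordered children of a node labelled `X` in a derivation tree. -/
def children (X : ℕ) : List ℕ := childrenOf (G.rhs X)

/-- The string `val(X)` derived by `X`. -/
def val (X : ℕ) : List α :=
  match _h : G.rhs X with
  | none => []
  | some (.char a) => [a]
  | some (.pair l r) => val l ++ val r
  | some (.pow x k) => if _hk : k = 0 then [] else (List.replicate k (val x)).flatten
termination_by G.acyclic.wrap X
decreasing_by
  all_goals
    change _ ∈ childrenOf (G.rhs X)
    rw [_h]
    simp [childrenOf, WellFounded.wrap, *]

/-- `val⁺` of a sequence of variables. -/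
def valPlus (y : List ℕ) : List α := (y.map G.val).flatten

/-- The nodes of the derivation tree of `X` are addressed by paths from the root: the path
`i₁, i₂, …` goes to child number `i₁` (from `0`) of the root, then to its child number `i₂`, and so
on. `label X π` is the variable at the node `π`, and `none` if the tree has no such node. The
terminal characters below the variables `X → a` are not counted as nodes. -/
def label (X : ℕ) : List ℕ → Option ℕ
  | [] => some X
  | i :: π =>
    match (G.children X)[i]? with
    | none => none
    | some Y => label Y π

/-- The position (from `0`) in `val(X)` at which the string derived by the node `π` of the
derivation tree of `X` begins. -/
def offset (X : ℕ) : List ℕ → ℕ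
  | [] => 0
  | i :: π =>
    match (G.children X)[i]? with
    | none => 0
    | some Y => (G.valPlus ((G.children X).take i)).length + offset Y π

/-! ### Signature encodings -/

open Classical in
/-- `Sig` on characters, pairs and runs: the left-hand side of the assignment with the given
right-hand side, if there is one. -/
noncomputable def sig (x : Rhs α) : Option ℕ :=
  if h : ∃ e, G.rhs e = some x then some h.choose else none

/-- `Sig` on blocks of length two to four, evaluated from left to right. -/
noncomputable def sigBlock : List ℕ → Option ℕ
  | [a, b] => G.sig (.pair a b)
  | [a, b, c] => (G.sig (.pair a b)).bind fun u => G.sig (.pair u c)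
  | [a, b, c, d] =>
    (G.sig (.pair a b)).bind fun u => (G.sig (.pair u c)).bind fun v => G.sig (.pair v d)
  | _ => none

/-- `Sig⁺` of a string. -/
noncomputable def sigChars (T : List α) : Option (List ℕ) :=
  T.mapM fun a => G.sig (.char a)

/-- `Sig⁺` of a sequence of runs. -/
noncomputable def sigRuns (s : List (ℕ × ℕ)) : Option (List ℕ) :=
  s.mapM fun r => G.sig (.pow r.1 r.2)

/-- `Sig⁺` of a sequence of blocks. -/
noncomputable def sigBlocks (q : List (List ℕ)) : Option (List ℕ) :=
  q.mapM G.sigBlock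

/-- `Shrink_t^T`, if all signatures it needs are defined. -/
noncomputable def shrink {W : ℕ} (f : (Fin (logStar W + 11) → ℕ) → Bool) (T : List α) :
    ℕ → Option (List ℕ)
  | 0 => G.sigChars T
  | t + 1 =>
    (shrink f T t).bind fun s => (G.sigRuns (epow s)).bind fun p => G.sigBlocks (eblock f p)

/-- `Pow_t^T`, if all signatures it needs are defined. -/
noncomputable def pow {W : ℕ} (f : (Fin (logStar W + 11) → ℕ) → Bool) (T : List α) (t : ℕ) :
    Option (List ℕ) :=
  (G.shrink f T t).bind fun s => G.sigRuns (epow s)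

/-- `G` is the signature encoding of `T`, for the parsing function `f` and with signatures in
`[1..M]`: all signatures in `Shrink_t^T` and `Pow_t^T` for `t ≤ h` are defined and the start symbol
is the single element of `Pow_h^T`, where `h` is the least `t` with `|Pow_t^T| = 1`. (There are no
other assignments than those needed for this, since `G` has no useless variables.) -/
def IsSignatureEncoding (M : ℕ) (f : (Fin (logStar M + 11) → ℕ) → Bool) (T : List α) : Prop :=
  (∀ X ∈ G.vars, X ≤ M) ∧
  ∃ h, G.pow f T h = some [G.start] ∧ ∀ t < h, ∀ p, G.pow f T t = some p → p.length ≠ 1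

/-- The level of a variable. In a signature encoding, `Shrink_0` consists of characters, `Pow_t`
of runs of signatures from `Shrink_t`, and the signatures produced for `Shrink_{t+1}` (those of
blocks and those of the proper prefixes of blocks of length three and four) are pairs whose right
component is in `Pow_t`; so the signatures of level `t` are those produced by `Shrink_t` or
`Pow_t`. -/
def level (X : ℕ) : ℕ :=
  match h : G.rhs X with
  | none => 0
  | some (.char _) => 0
  | some (.pair _ r) => level r + 1
  | some (.pow x k) => if _hk : k = 0 then 0 else level x
termination_by G.acyclic.wrap X
decreasing_by
  all_goals
    change _ ∈ childrenOf (G.rhs X)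
    rw [h]
    simp [childrenOf, WellFounded.wrap, *]

/-! ### Common sequences -/

end RLSLP

/-- `L̂`: the longest prefix of `s` that consists of a single run. -/
def hatL (s : List ℕ) : List ℕ := s.takeWhile fun x => x == s.headD 0

/-- `R̂`: the longest suffix of `s` that consists of a single run. -/
def hatR (s : List ℕ) : List ℕ := (hatL s.reverse).reverse

/-- The length of `L`, the shortest prefix of `p` of length at least `Δ_L` such that `d[|L|+1] = 1`
(positions counted from `1`). -/
noncomputable def lenL {W : ℕ} (f : (Fin (logStar W + 11) → ℕ) → Bool) (p : List ℕ) : ℕ :=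
  sInf {l | deltaL W ≤ l ∧ l < p.length ∧ bit f p l = true}

/-- The length of `R`, the shortest suffix of `p` of length at least `Δ_R + 1` such that
`d[|d|-|R|+1] = 1` (positions counted from `1`). -/
noncomputable def lenR {W : ℕ} (f : (Fin (logStar W + 11) → ℕ) → Bool) (p : List ℕ) : ℕ :=
  sInf {r | deltaR + 1 ≤ r ∧ r ≤ p.length ∧ bit f p (p.length - r) = true}

/-- The list `l` without its first `a` and its last `b` entries. -/
def trim {β : Type*} (a b : ℕ) (l : List β) : List β := (l.take (l.length - b)).drop a

namespace RLSLP

variable {α : Type*} (G : RLSLP α)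

/-- The step from `XShrink_t` to `XPow_t`: remove the first and the last run, and apply `Sig⁺` to
the runs that remain. -/
noncomputable def xpowStep (s : List ℕ) : Option (List ℕ) :=
  G.sigRuns (epow (trim (hatL s).length (hatR s).length s))

/-- The step from `XPow_t` to `XShrink_{t+1}`: with the bits of all of `XPow_t`, remove the prefix
`L_t` and the suffix `R_t`, and apply `Sig⁺` to the blocks of the sequence that remains. -/
noncomputable def xshrinkStep {W : ℕ} (f : (Fin (logStar W + 11) → ℕ) → Bool) (p : List ℕ) :
    Option (List ℕ) :=
  G.sigBlocks (cut (trim (lenL f p) (lenR f p) (withBits f p)))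

/-- `XShrink_t^P`. -/
noncomputable def xshrink {W : ℕ} (f : (Fin (logStar W + 11) → ℕ) → Bool) (P : List α) :
    ℕ → Option (List ℕ)
  | 0 => G.sigChars P
  | t + 1 => (xshrink f P t).bind fun s => (G.xpowStep s).bind fun p => G.xshrinkStep f p

/-- `h^P`: the least `t` such that `|Epow(XShrink_t^P)| ≤ Δ_L + Δ_R + 9`. -/
noncomputable def hP {W : ℕ} (f : (Fin (logStar W + 11) → ℕ) → Bool) (P : List α) : ℕ :=
  sInf {t | ∃ s, G.xshrink f P t = some s ∧ (epow s).length ≤ deltaL W + deltaR + 9}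

/-- `L̂_t^P L_t^P`, where `L_t^P` is a prefix of `XPow_t^P`. -/
noncomputable def leftPart {W : ℕ} (f : (Fin (logStar W + 11) → ℕ) → Bool) (P : List α) (t : ℕ) :
    Option (List ℕ) :=
  (G.xshrink f P t).bind fun s => (G.xpowStep s).bind fun p =>
    some (hatL s ++ p.take (lenL f p))

/-- `R_t^P R̂_t^P`, where `R_t^P` is a suffix of `XPow_t^P`. -/
noncomputable def rightPart {W : ℕ} (f : (Fin (logStar W + 11) → ℕ) → Bool) (P : List α) (t : ℕ) :
    Option (List ℕ) :=
  (G.xshrink f P t).bind fun s => (G.xpowStep s).bind fun p =>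
    some (p.drop (p.length - lenR f p) ++ hatR s)

/-- The common sequence of `P`, with `h = h^P`:
`Uniq(P) = L̂_0 L_0 ⋯ L̂_{h-1} L_{h-1} XShrink_h R_{h-1} R̂_{h-1} ⋯ R_0 R̂_0`. -/
noncomputable def uniq {W : ℕ} (f : (Fin (logStar W + 11) → ℕ) → Bool) (P : List α) :
    Option (List ℕ) :=
  ((List.range (G.hP f P)).mapM (G.leftPart f P)).bind fun l =>
  (G.xshrink f P (G.hP f P)).bind fun m =>
  ((List.range (G.hP f P)).reverse.mapM (G.rightPart f P)).bind fun r =>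
    some (l.flatten ++ m ++ r.flatten)

/-- The node `π` of the derivation tree of `e` represents the `j`-th entry of the sequence `U` of
signatures that is read in `val(e)` from position `i` on (all counted from `0`). -/
def RepresentsEntry (e i : ℕ) (U : List ℕ) (j : ℕ) (π : List ℕ) : Prop :=
  ∃ x, U[j]? = some x ∧ G.label e π = some x ∧
    G.offset e π = i + (G.valPlus (U.take j)).length

/-- The occurrence of `P` at position `i` of `val(e)` is represented by the sequence `U` of
signatures in the derivation tree of `e`. -/
def Represents (e i : ℕ) (P : List α) (U : List ℕ) : Prop :=
  G.valPlus U = P ∧ ∀ j < U.length, ∃ π, G.RepresentsEntry e i U j π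

/-- The nodes of the subtree of the derivation tree of `e` that is induced by the paths from the
root to the parents of the nodes representing `U` at position `i`. -/
def inducedSubtree (e i : ℕ) (U : List ℕ) : Set (List ℕ) :=
  {π | ∃ (j : ℕ) (μ : List ℕ) (c : ℕ), G.RepresentsEntry e i U j (μ ++ [c]) ∧ π <+: μ}

/-- The nodes of level `t` in the derivation tree of `e`. -/
def levelNodes (e t : ℕ) : Set (List ℕ) := {π | ∃ x, G.label e π = some x ∧ G.level x = t}

end RLSLP

end SigEnc

namespace SigEnc
namespace RLSLP

variable {α : Type*} (G : RLSLP α)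

/-! ### Derivation trees -/

/-! All counting is done in the derivation tree of the start symbol, where the tree of `e` hangs at
some node. Give each signature a rank: its level, and within the level a number that orders
characters or block prefixes by length and puts runs last. Ranks strictly increase towards the root,
so nodes of equal rank derive disjoint parts of the string (`HasRank.eq_of_overlap`). A run of level
`t + 1` begins with a block of at least two runs of level `t`; hence, in any interval, the number of
starts of runs of level `t + 1` is about half of that of level `t` (`powStarts_halving`).

The common sequence is built in rounds, with a middle part that stays a contiguous piece of
`Shrink_t` of `T`. This works because a run not at the border of the piece, and a bit whose window
stays inside, are the same for the piece and for the whole layer (`exists_xshrinkStep`). A round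
adds at most `Δ_L + 4` runs on the left and `9` on the right, and the step to the next level halves
what was there before. So at every level `s` the entries of level at most `s` extend over only
`O(log* M)` starts of runs of level `s` on each side (`State.succ`), although they may derive very
long strings.

Group the inner nodes of the subtree into rounds: round `s` has the runs of level `s` and the pairs
of level `s + 1`, each of which begins where a run of level `s` begins. An inner node of round `s`
lies above an entry of level at most `s`, hence meets one of the two outer parts just described.
Nodes of one rank that meet an interval are at most one more than the starts inside it, and a round
has four ranks, so a round has `O(log* M)` nodes (`roundNodes_le`). A level meets at most two
rounds.

For the total there are `h = h^P ≤ log₂|P|` rounds with this bound. From level `h` on, the whole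
occurrence has only `O(log* M)` starts, and this number keeps halving, so the later rounds
contribute a geometric series plus a constant for each level of the tree. A signature of level `t`
derives at least `2 ^ t` characters, so there are `O(log |s|)` levels. -/

@[simp] theorem valPlus_nil : G.valPlus [] = [] := rfl

@[simp] theorem valPlus_cons (x : ℕ) (y : List ℕ) : G.valPlus (x :: y) = G.val x ++ G.valPlus y := by
  simp [valPlus]

@[simp] theorem valPlus_append (x y : List ℕ) :
    G.valPlus (x ++ y) = G.valPlus x ++ G.valPlus y := by
  simp [valPlus]

theorem valPlus_replicate (k x : ℕ) :
    G.valPlus (List.replicate k x) = (List.replicate k (G.val x)).flatten := by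
  simp [valPlus]

variable {G}

theorem val_of_char {X : ℕ} {a : α} (h : G.rhs X = some (.char a)) : G.val X = [a] := by
  rw [val]; split <;> simp_all

theorem val_of_pair {X l r : ℕ} (h : G.rhs X = some (.pair l r)) :
    G.val X = G.val l ++ G.val r := by
  rw [val]; split <;> simp_all

theorem val_of_pow {X x k : ℕ} (h : G.rhs X = some (.pow x k)) :
    G.val X = (List.replicate k (G.val x)).flatten := by
  rw [val]; split <;> simp_all

theorem level_of_char {X : ℕ} {a : α} (h : G.rhs X = some (.char a)) : G.level X = 0 := by
  rw [level]; split <;> simp_all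

theorem level_of_pair {X l r : ℕ} (h : G.rhs X = some (.pair l r)) :
    G.level X = G.level r + 1 := by
  rw [level]; split <;> simp_all

theorem level_of_pow {X x k : ℕ} (h : G.rhs X = some (.pow x k)) :
    G.level X = G.level x := by
  have hk := G.exponent_pos X x k h
  rw [level]; split <;> simp_all
  omega

theorem children_of_pair {X l r : ℕ} (h : G.rhs X = some (.pair l r)) :
    G.children X = [l, r] := by simp [children, h, childrenOf]

theorem children_of_pow {X x k : ℕ} (h : G.rhs X = some (.pow x k)) :
    G.children X = List.replicate k x := by simp [children, h, childrenOf]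

theorem children_of_char {X : ℕ} {a : α} (h : G.rhs X = some (.char a)) :
    G.children X = [] := by simp [children, h, childrenOf]

theorem valPlus_children {X : ℕ} (h : G.children X ≠ []) :
    G.valPlus (G.children X) = G.val X := by
  rcases hx : G.rhs X with _ | (a | ⟨l, r⟩ | ⟨x, k⟩)
  · simp [children, hx, childrenOf] at h
  · simp [children, hx, childrenOf] at h
  · rw [children_of_pair hx, val_of_pair hx]; simp
  · rw [children_of_pow hx, val_of_pow hx, valPlus_replicate]

@[simp] theorem label_nil (X : ℕ) : G.label X [] = some X := rfl

@[simp] theorem offset_nil (X : ℕ) : G.offset X [] = 0 := rfl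

theorem label_cons {X i Y : ℕ} (h : (G.children X)[i]? = some Y) (π : List ℕ) :
    G.label X (i :: π) = G.label Y π := by
  rw [label, h]

theorem offset_cons {X i Y : ℕ} (h : (G.children X)[i]? = some Y) (π : List ℕ) :
    G.offset X (i :: π) = (G.valPlus ((G.children X).take i)).length + G.offset Y π := by
  rw [offset, h]

theorem label_cons_eq_some {X i Z : ℕ} {π : List ℕ} (h : G.label X (i :: π) = some Z) :
    ∃ Y, (G.children X)[i]? = some Y ∧ G.label Y π = some Z := by
  rcases hY : (G.children X)[i]? with _ | Y
  · rw [label, hY] at h; cases h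
  · exact ⟨Y, rfl, by rwa [label_cons hY] at h⟩

theorem label_append {X Y : ℕ} {π : List ℕ} (h : G.label X π = some Y) (σ : List ℕ) :
    G.label X (π ++ σ) = G.label Y σ := by
  induction π generalizing X with
  | nil => simp at h; subst h; rfl
  | cons i π ih =>
    obtain ⟨Z, hZ, hZ'⟩ := label_cons_eq_some h
    rw [List.cons_append, label_cons hZ, ih hZ']

theorem exists_label_of_append {X Z : ℕ} {π σ : List ℕ} (h : G.label X (π ++ σ) = some Z) :
    ∃ Y, G.label X π = some Y ∧ G.label Y σ = some Z := by
  induction π generalizing X with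
  | nil => exact ⟨X, rfl, h⟩
  | cons i π ih =>
    obtain ⟨Y, hY, hY'⟩ := label_cons_eq_some h
    obtain ⟨Y', h1, h2⟩ := ih hY'
    exact ⟨Y', by rw [label_cons hY, h1], h2⟩

theorem offset_append {X Y : ℕ} {π : List ℕ} (h : G.label X π = some Y) (σ : List ℕ) :
    G.offset X (π ++ σ) = G.offset X π + G.offset Y σ := by
  induction π generalizing X with
  | nil => simp at h; subst h; simp
  | cons i π ih =>
    obtain ⟨Z, hZ, hZ'⟩ := label_cons_eq_some h
    rw [List.cons_append, offset_cons hZ, offset_cons hZ, ih hZ', add_assoc]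

theorem valPlus_take_add {y : List ℕ} {i x : ℕ} (h : y[i]? = some x) :
    (G.valPlus (y.take i)).length + (G.val x).length = (G.valPlus (y.take (i + 1))).length := by
  rw [List.take_add_one, h]; simp

theorem valPlus_take_le (y : List ℕ) {i j : ℕ} (h : i ≤ j) :
    (G.valPlus (y.take i)).length ≤ (G.valPlus (y.take j)).length := by
  obtain ⟨k, rfl⟩ := Nat.exists_eq_add_of_le h
  rw [List.take_add]; simp

theorem valPlus_take_le_all (y : List ℕ) (i : ℕ) :
    (G.valPlus (y.take i)).length ≤ (G.valPlus y).length := by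
  conv_rhs => rw [← List.take_append_drop i y, valPlus_append, List.length_append]
  omega

theorem valPlus_take_add_le {y : List ℕ} {i x : ℕ} (h : y[i]? = some x) :
    (G.valPlus (y.take i)).length + (G.val x).length ≤ (G.valPlus y).length := by
  rw [valPlus_take_add h]; exact valPlus_take_le_all _ _

theorem offset_add_le {X Y : ℕ} {π : List ℕ} (h : G.label X π = some Y) :
    G.offset X π + (G.val Y).length ≤ (G.val X).length := by
  induction π generalizing X with
  | nil => simp at h; subst h; simp
  | cons i π ih =>
    obtain ⟨Z, hZ, hZ'⟩ := label_cons_eq_some h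
    have h1 := ih hZ'
    have h2 := valPlus_take_add_le (G := G) hZ
    rw [valPlus_children (by rintro h; simp [h] at hZ)] at h2
    rw [offset_cons hZ]; omega

/-- The string derived by a node is the part of the derived string that begins at its offset. -/
theorem val_eq_append_of_label {X Y : ℕ} {π : List ℕ} (h : G.label X π = some Y) :
    ∃ u v, G.val X = u ++ G.val Y ++ v ∧ u.length = G.offset X π := by
  induction π generalizing X with
  | nil => simp at h; subst h; exact ⟨[], [], by simp⟩
  | cons i π ih =>
    obtain ⟨Z, hZ, hZ'⟩ := label_cons_eq_some h
    obtain ⟨u, v, huv, hu⟩ := ih hZ'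
    refine ⟨G.valPlus ((G.children X).take i) ++ u, v ++ G.valPlus ((G.children X).drop (i + 1)),
      ?_, by rw [offset_cons hZ]; simp [hu]⟩
    rw [← valPlus_children (by rintro h; simp [h] at hZ)]
    conv_lhs => rw [← List.take_append_drop (i + 1) (G.children X), List.take_add_one, hZ]
    simp [huv]

/-- Two nodes that derive overlapping parts of the string are comparable. -/
theorem prefix_or_prefix_of_overlap {X Y Z : ℕ} {π σ : List ℕ} (hπ : G.label X π = some Y)
    (hσ : G.label X σ = some Z) (h1 : G.offset X π < G.offset X σ + (G.val Z).length)
    (h2 : G.offset X σ < G.offset X π + (G.val Y).length) : π <+: σ ∨ σ <+: π := by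
  induction π generalizing X σ with
  | nil => left; simp
  | cons i π ih =>
    cases σ with
    | nil => right; simp
    | cons j σ =>
      obtain ⟨A, hA, hA'⟩ := label_cons_eq_some hπ
      obtain ⟨B, hB, hB'⟩ := label_cons_eq_some hσ
      rw [offset_cons hA, offset_cons hB] at h1 h2
      have e1 := offset_add_le hA'
      have e2 := offset_add_le hB'
      have e3 := valPlus_take_add (G := G) hA
      have e4 := valPlus_take_add (G := G) hB
      rcases lt_trichotomy i j with hij | hij | hij
      · have := valPlus_take_le (G := G) (G.children X) (show i + 1 ≤ j from hij)
        omega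
      · subst hij
        rw [hA] at hB
        cases hB
        rcases ih hA' hB' (by omega) (by omega) with h | h
        · left; simpa using h
        · right; simpa using h
      · have := valPlus_take_le (G := G) (G.children X) (show j + 1 ≤ i from hij)
        omega

/-! ### Ranks -/

/-- The shape of the variables of a signature encoding. In `HasRank G t c x`, `t` is the level of
`x`; `c` is `0` for characters, `4` for runs, and one less than the number of runs in the block (or
proper prefix of a block) for pairs. -/
inductive HasRank (G : RLSLP α) : ℕ → ℕ → ℕ → Prop
  | char {x : ℕ} {a : α} (h : G.rhs x = some (.char a)) : HasRank G 0 0 x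
  | pow {x y k t c : ℕ} (h : G.rhs x = some (.pow y k)) (hc : c ≤ 3) (hy : HasRank G t c y) :
      HasRank G t 4 x
  | pairBase {x l r t : ℕ} (h : G.rhs x = some (.pair l r)) (hl : HasRank G t 4 l)
      (hr : HasRank G t 4 r) : HasRank G (t + 1) 1 x
  | pairStep {x l r t c : ℕ} (h : G.rhs x = some (.pair l r)) (h1 : 1 ≤ c) (h2 : c ≤ 2)
      (hl : HasRank G (t + 1) c l) (hr : HasRank G t 4 r) : HasRank G (t + 1) (c + 1) x

namespace HasRank

theorem le_four {t c x : ℕ} (h : HasRank G t c x) : c ≤ 4 := by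
  cases h <;> omega

theorem level_eq {t c x : ℕ} (h : HasRank G t c x) : G.level x = t := by
  induction h with
  | char h => exact level_of_char h
  | pow h _ _ ih => rw [level_of_pow h, ih]
  | pairBase h _ _ _ ih => rw [level_of_pair h, ih]
  | pairStep h _ _ _ _ _ ih => rw [level_of_pair h, ih]

theorem unique {t c t' c' x : ℕ} (h : HasRank G t c x) (h' : HasRank G t' c' x) : c = c' := by
  induction h generalizing t' c' with
  | char h => cases h' <;> simp_all
  | pow h _ _ ih => cases h' <;> simp_all
  | pairBase h hl _ ihl _ =>
    cases h' with
    | pairBase => rfl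
    | char h' => simp_all
    | pow h' => simp_all
    | pairStep h' _ _ hl' =>
      rw [h] at h'; cases h'
      have := ihl hl'; omega
  | pairStep h _ _ hl _ ihl _ =>
    cases h' with
    | pairBase h' hl' =>
      rw [h] at h'; cases h'
      have := ihl hl'; omega
    | char h' => simp_all
    | pow h' => simp_all
    | pairStep h' _ _ hl' =>
      rw [h] at h'; cases h'
      rw [ihl hl']

/-- The weight `5 t + c` orders ranks lexicographically, as `c ≤ 4`, and falls strictly from parent
to child. This makes nodes of equal rank incomparable. -/
theorem exists_of_mem_children {t c x y : ℕ} (h : HasRank G t c x) (hy : y ∈ G.children x) :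
    ∃ t' c', HasRank G t' c' y ∧ 5 * t' + c' < 5 * t + c := by
  cases h with
  | char h => simp [children_of_char h] at hy
  | pow h _ h' =>
    rw [children_of_pow h] at hy
    rw [List.eq_of_mem_replicate hy]
    exact ⟨_, _, h', by omega⟩
  | pairBase h hl hr =>
    rw [children_of_pair h] at hy
    simp only [List.mem_cons, List.not_mem_nil, or_false] at hy
    rcases hy with rfl | rfl
    · exact ⟨_, _, hl, by omega⟩
    · exact ⟨_, _, hr, by omega⟩
  | pairStep h _ _ hl hr =>
    rw [children_of_pair h] at hy
    simp only [List.mem_cons, List.not_mem_nil, or_false] at hy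
    rcases hy with rfl | rfl
    · exact ⟨_, _, hl, by omega⟩
    · exact ⟨_, _, hr, by omega⟩

theorem exists_of_label {t c x y : ℕ} {σ : List ℕ} (h : HasRank G t c x)
    (hσ : G.label x σ = some y) :
    ∃ t' c', HasRank G t' c' y ∧ (σ = [] ∧ t' = t ∧ c' = c ∨ 5 * t' + c' < 5 * t + c) := by
  induction σ generalizing x t c with
  | nil => simp at hσ; subst hσ; exact ⟨t, c, h, by simp⟩
  | cons i σ ih =>
    obtain ⟨z, hz, hz'⟩ := label_cons_eq_some hσ
    obtain ⟨t1, c1, h1, h1'⟩ := h.exists_of_mem_children (List.mem_of_getElem? hz)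
    obtain ⟨t2, c2, h2, h2'⟩ := ih h1 hz'
    exact ⟨t2, c2, h2, by omega⟩

theorem rank_unique {t c t' c' x : ℕ} (h : HasRank G t c x) (h' : HasRank G t' c' x) :
    t = t' ∧ c = c' :=
  ⟨by rw [← h.level_eq, ← h'.level_eq], h.unique h'⟩

theorem two_pow_le {t c x : ℕ} (h : HasRank G t c x) : 2 ^ t ≤ (G.val x).length := by
  induction h with
  | char h => simp [val_of_char h]
  | @pow x y k t c h _ _ ih =>
    rw [val_of_pow h]
    have := G.exponent_pos _ _ _ h
    simp only [List.length_flatten, List.map_replicate, List.sum_replicate, smul_eq_mul]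
    nlinarith
  | pairBase h _ _ ih1 ih2 => rw [val_of_pair h, List.length_append, pow_succ]; omega
  | pairStep h _ _ _ _ ih1 ih2 => rw [val_of_pair h, List.length_append]; omega

theorem val_pos {t c x : ℕ} (h : HasRank G t c x) : 0 < (G.val x).length :=
  lt_of_lt_of_le (by positivity) h.two_pow_le

/-- Overlapping nodes of equal rank are equal. -/
theorem eq_of_overlap {X x y t c : ℕ} {π σ : List ℕ}
    (hx : HasRank G t c x) (hy : HasRank G t c y) (hπ : G.label X π = some x)
    (hσ : G.label X σ = some y) (h1 : G.offset X π < G.offset X σ + (G.val y).length)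
    (h2 : G.offset X σ < G.offset X π + (G.val x).length) : π = σ := by
  have key : ∀ {π σ : List ℕ} {x y : ℕ}, HasRank G t c x → HasRank G t c y →
      G.label X π = some x → G.label X σ = some y → π <+: σ → π = σ := by
    rintro π σ x y hx hy hπ hσ ⟨τ, rfl⟩
    rw [label_append hπ] at hσ
    obtain ⟨t', c', h', h''⟩ := hx.exists_of_label hσ
    obtain ⟨rfl, rfl⟩ := hy.rank_unique h'
    rcases h'' with ⟨rfl, _⟩ | h
    · simp
    · omega
  rcases prefix_or_prefix_of_overlap hπ hσ h1 h2 with h | h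
  · exact key hx hy hπ hσ h
  · exact (key hy hx hσ hπ h).symm

end HasRank

/-! ### Starts of runs and their halving from level to level -/

/-- The positions at which the runs of level `t` begin in the derivation tree of `r`. -/
def powStarts (G : RLSLP α) (r t : ℕ) : Set ℕ :=
  {o | ∃ π x, G.label r π = some x ∧ HasRank G t 4 x ∧ G.offset r π = o}

/-- The number of elements of `S` in `[x, y)`. -/
noncomputable def countIn (S : Set ℕ) (x y : ℕ) : ℕ := (S ∩ Set.Ico x y).ncard

theorem finite_inter_Ico (S : Set ℕ) (x y : ℕ) : (S ∩ Set.Ico x y).Finite :=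
  (Set.finite_Ico x y).subset Set.inter_subset_right

theorem countIn_mono (S : Set ℕ) {x y x' y' : ℕ} (hx : x' ≤ x) (hy : y ≤ y') :
    countIn S x y ≤ countIn S x' y' :=
  Set.ncard_le_ncard (Set.inter_subset_inter_right _ (Set.Ico_subset_Ico hx hy))
    (finite_inter_Ico _ _ _)

theorem countIn_le_add (S : Set ℕ) (x y z : ℕ) :
    countIn S x z ≤ countIn S x y + countIn S y z := by
  refine le_trans (Set.ncard_le_ncard ?_ ((finite_inter_Ico S x y).union (finite_inter_Ico S y z)))
    (Set.ncard_union_le _ _)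
  rintro o ⟨ho, h1, h2⟩
  rcases lt_or_ge o y with h | h
  · exact Or.inl ⟨ho, h1, h⟩
  · exact Or.inr ⟨ho, h, h2⟩

theorem countIn_self (S : Set ℕ) (x : ℕ) : countIn S x x = 0 := by simp [countIn]

/-- If `S` has further elements between any two elements of `S' ⊆ S`, then `S'` has at most about
half as many elements as `S` in every interval. -/
theorem two_mul_countIn_le {S S' : Set ℕ} (hS : S' ⊆ S)
    (h : ∀ o ∈ S', ∃ o' ∈ S, o < o' ∧ ∀ o'' ∈ S', o < o'' → o' < o'') (x y : ℕ) :
    2 * countIn S' x y ≤ countIn S x y + 1 := by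
  classical
  choose! g hg1 hg2 hg3 using h
  set A := (finite_inter_Ico S' x y).toFinset with hA
  set B := (finite_inter_Ico S x y).toFinset with hB
  have hAc : countIn S' x y = A.card := Set.ncard_eq_toFinset_card _ (finite_inter_Ico S' x y)
  have hBc : countIn S x y = B.card := Set.ncard_eq_toFinset_card _ (finite_inter_Ico S x y)
  have memA : ∀ {o}, o ∈ A ↔ o ∈ S' ∧ x ≤ o ∧ o < y := by simp [hA]
  have memB : ∀ {o}, o ∈ B ↔ o ∈ S ∧ x ≤ o ∧ o < y := by simp [hB]
  rcases A.eq_empty_or_nonempty with h0 | hne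
  · rw [hAc, h0]; simp
  set m := A.max' hne
  have hm : m ∈ A := A.max'_mem hne
  -- For every element of `A` but the last, the witness in `S` lies before the next element of `A`,
  -- hence still inside the interval. The witness of the maximum may leave it, which costs the `+
  -- 1`.
  have hsub : A ∪ (A.erase m).image g ⊆ B := by
    intro o ho
    rcases Finset.mem_union.1 ho with ho | ho
    · obtain ⟨h1, h2⟩ := memA.1 ho
      exact memB.2 ⟨hS h1, h2⟩
    · obtain ⟨o', ho', rfl⟩ := Finset.mem_image.1 ho
      obtain ⟨hne', ho'⟩ := Finset.mem_erase.1 ho'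
      obtain ⟨h1, h2, h3⟩ := memA.1 ho'
      obtain ⟨m1, m2, m3⟩ := memA.1 hm
      have hlt : o' < m := lt_of_le_of_ne (A.le_max' _ ho') hne'
      have := hg2 o' h1
      have := hg3 o' h1 m m1 hlt
      exact memB.2 ⟨hg1 o' h1, by omega, by omega⟩
  have hdisj : Disjoint A ((A.erase m).image g) := by
    rw [Finset.disjoint_left]
    intro o ho ho'
    obtain ⟨p, hp, rfl⟩ := Finset.mem_image.1 ho'
    have h1 := (memA.1 (Finset.mem_erase.1 hp).2).1
    exact lt_irrefl _ (hg3 p h1 _ (memA.1 ho).1 (hg2 p h1))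
  have hinj : Set.InjOn g (A.erase m : Finset ℕ) := by
    intro o ho o' ho' he
    have h1 := (memA.1 (Finset.mem_erase.1 ho).2).1
    have h2 := (memA.1 (Finset.mem_erase.1 ho').2).1
    rcases lt_trichotomy o o' with hl | hl | hl
    · have := hg3 o h1 o' h2 hl
      have := hg2 o' h2
      omega
    · exact hl
    · have := hg3 o' h2 o h1 hl
      have := hg2 o h1
      omega
  have := Finset.card_le_card hsub
  rw [Finset.card_union_of_disjoint hdisj, Finset.card_image_of_injOn hinj,
    Finset.card_erase_of_mem hm] at this
  have := Finset.card_pos.2 hne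
  omega

/-- The left spine below a pair leads to two neighbouring runs of the level below. -/
theorem HasRank.exists_pow_pow {t c x : ℕ} (h : HasRank G (t + 1) c x) (hc : c ≤ 3) :
    ∃ π σ y z, G.label x π = some y ∧ HasRank G t 4 y ∧ G.offset x π = 0 ∧
      G.label x σ = some z ∧ HasRank G t 4 z ∧ 0 < G.offset x σ := by
  obtain ⟨s, hs⟩ : ∃ s, s = t + 1 := ⟨_, rfl⟩
  rw [← hs] at h
  induction h with
  | char h => omega
  | pow h => omega
  | @pairBase x l r t' h hl hr =>
    cases hs
    have h0 : (G.children x)[0]? = some l := by simp [children_of_pair h]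
    have h1 : (G.children x)[1]? = some r := by simp [children_of_pair h]
    refine ⟨[0], [1], l, r, ?_, hl, ?_, ?_, hr, ?_⟩
    · rw [label_cons h0]; rfl
    · rw [offset_cons h0]; simp
    · rw [label_cons h1]; rfl
    · rw [offset_cons h1]; simpa [children_of_pair h] using hl.val_pos
  | @pairStep x l r t' c' h _ _ hl hr ih =>
    cases hs
    obtain ⟨π, σ, y, z, a1, a2, a3, a4, a5, a6⟩ := ih (by omega) rfl
    have h0 : (G.children x)[0]? = some l := by simp [children_of_pair h]
    refine ⟨0 :: π, 0 :: σ, y, z, ?_, a2, ?_, ?_, a5, ?_⟩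
    · rw [label_cons h0, a1]
    · rw [offset_cons h0, a3]; simp
    · rw [label_cons h0, a4]
    · rw [offset_cons h0]; omega

theorem HasRank.exists_pow_pow_of_pow {t x : ℕ} (h : HasRank G (t + 1) 4 x) :
    ∃ π σ y z, G.label x π = some y ∧ HasRank G t 4 y ∧ G.offset x π = 0 ∧
      G.label x σ = some z ∧ HasRank G t 4 z ∧ 0 < G.offset x σ := by
  cases h with
  | @pow _ y' k _ c h hc hy =>
    obtain ⟨π, σ, y, z, a1, a2, a3, a4, a5, a6⟩ := hy.exists_pow_pow hc
    have h0 : (G.children x)[0]? = some y' := by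
      have := G.exponent_pos _ _ _ h
      rw [children_of_pow h, List.getElem?_replicate]; simp; omega
    refine ⟨0 :: π, 0 :: σ, y, z, ?_, a2, ?_, ?_, a5, ?_⟩
    · rw [label_cons h0, a1]
    · rw [offset_cons h0, a3]; simp
    · rw [label_cons h0, a4]
    · rw [offset_cons h0]; omega
  | pairStep h _ h2 => omega

/-- The first run of level `t` inside a run of level `t + 1` shares its start, and the second begins
before the outer run ends, so before any later run of level `t + 1`. -/
theorem powStarts_halving (r t x y : ℕ) :
    2 * countIn (powStarts G r (t + 1)) x y ≤ countIn (powStarts G r t) x y + 1 := by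
  apply two_mul_countIn_le
  · rintro o ⟨π, x, hπ, hx, rfl⟩
    obtain ⟨π', σ, y, z, a1, a2, a3, a4, a5, a6⟩ := hx.exists_pow_pow_of_pow
    exact ⟨π ++ π', y, by rw [label_append hπ, a1], a2, by rw [offset_append hπ, a3, add_zero]⟩
  · rintro o ⟨π, x, hπ, hx, rfl⟩
    obtain ⟨π', σ, y, z, a1, a2, a3, a4, a5, a6⟩ := hx.exists_pow_pow_of_pow
    refine ⟨_, ⟨π ++ σ, z, by rw [label_append hπ, a4], a5, rfl⟩, ?_, ?_⟩
    · rw [offset_append hπ]; omega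
    · rintro o ⟨τ, w, hτ, hw, rfl⟩ hlt
      by_contra hcon
      rw [offset_append hπ] at hcon
      have := offset_add_le a4
      have := a5.val_pos
      have h := hx.eq_of_overlap hw hπ hτ (by omega) (by omega)
      subst h
      omega

/-- The ranks of runs of level `t` and of pairs of level `t + 1`. -/
def RankAbove (t t' c : ℕ) : Prop := t' = t ∧ c = 4 ∨ t' = t + 1 ∧ 1 ≤ c ∧ c ≤ 3

/-- The left spine of a pair of level `t + 1` ends in a run of level `t` with the same start. So the
starts of runs of level `t` control four ranks at once. -/
theorem HasRank.offset_mem_powStarts {r t t' c x : ℕ} {π : List ℕ} (h : HasRank G t' c x)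
    (hc : RankAbove t t' c) (hπ : G.label r π = some x) : G.offset r π ∈ powStarts G r t := by
  rcases hc with ⟨rfl, rfl⟩ | ⟨rfl, _, hc⟩
  · exact ⟨π, x, hπ, h, rfl⟩
  · obtain ⟨π', σ, y, z, a1, a2, a3, a4, a5, a6⟩ := h.exists_pow_pow hc
    exact ⟨π ++ π', y, by rw [label_append hπ, a1], a2, by rw [offset_append hπ, a3, add_zero]⟩

/-- Nodes of one rank that meet an interval. -/
theorem ncard_nodes_le {r t t' c x y : ℕ} (hc : RankAbove t t' c) (N : Set (List ℕ))
    (hN : ∀ π ∈ N, ∃ z, G.label r π = some z ∧ HasRank G t' c z ∧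
      x < G.offset r π + (G.val z).length ∧ G.offset r π < y) :
    N.Finite ∧ N.ncard ≤ countIn (powStarts G r t) (x + 1) y + 1 := by
  set F : Set ℕ := insert x (powStarts G r t ∩ Set.Ico (x + 1) y)
  have hF : F.Finite := (finite_inter_Ico _ _ _).insert x
  -- Starts at or before `x` are moved to `x`. At most one node of the rank is affected, because two
  -- such nodes would overlap at `x`.
  let g : List ℕ → ℕ := fun π => max x (G.offset r π)
  have hmaps : Set.MapsTo g N F := by
    intro π hπ
    obtain ⟨z, h1, h2, h3, h4⟩ := hN π hπ
    rcases le_or_gt (G.offset r π) x with h | h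
    · left; simp [g, h]
    · right
      have : g π = G.offset r π := by simp only [g]; omega
      rw [this]
      exact ⟨h2.offset_mem_powStarts hc h1, h, h4⟩
  have hinj : Set.InjOn g N := by
    intro π hπ σ hσ he
    obtain ⟨z, h1, h2, h3, h4⟩ := hN π hπ
    obtain ⟨w, k1, k2, k3, k4⟩ := hN σ hσ
    have := h2.val_pos
    have := k2.val_pos
    have he' : max x (G.offset r π) = max x (G.offset r σ) := he
    exact h2.eq_of_overlap k2 h1 k1 (by omega) (by omega)
  refine ⟨Set.Finite.of_injOn hmaps hinj hF, ?_⟩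
  exact le_trans (Set.ncard_le_ncard_of_injOn g hmaps hinj hF) (Set.ncard_insert_le _ _)

end RLSLP
end SigEnc

namespace SigEnc

/-! ### Runs -/

/-- The sequence with the given runs. -/
def expand (l : List (ℕ × ℕ)) : List ℕ := l.flatMap fun r => List.replicate r.2 r.1

@[simp] theorem expand_nil : expand [] = [] := rfl

@[simp] theorem expand_cons (r : ℕ × ℕ) (l : List (ℕ × ℕ)) :
    expand (r :: l) = List.replicate r.2 r.1 ++ expand l := by simp [expand]

@[simp] theorem expand_append (l m : List (ℕ × ℕ)) :
    expand (l ++ m) = expand l ++ expand m := by simp [expand]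

@[simp] theorem epow_nil : epow [] = [] := rfl

theorem epow_singleton (a : ℕ) : epow [a] = [(a, 1)] := rfl

theorem epow_cons_of_eq {s : List ℕ} {b k : ℕ} {r : List (ℕ × ℕ)} (h : epow s = (b, k) :: r) :
    epow (b :: s) = (b, k + 1) :: r := by simp [epow, h]

theorem epow_cons_of_ne {s : List ℕ} {a b k : ℕ} {r : List (ℕ × ℕ)} (h : epow s = (b, k) :: r)
    (hab : a ≠ b) : epow (a :: s) = (a, 1) :: (b, k) :: r := by simp [epow, h, hab]

theorem exists_epow_cons (a : ℕ) (s : List ℕ) :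
    ∃ k r, epow (a :: s) = (a, k + 1) :: r := by
  rcases h : epow s with _ | ⟨⟨b, k⟩, r⟩
  · exact ⟨0, [], by simp [epow, h]⟩
  · by_cases hab : a = b
    · subst hab; exact ⟨k, r, epow_cons_of_eq h⟩
    · exact ⟨0, _, epow_cons_of_ne h hab⟩

theorem expand_epow (s : List ℕ) : expand (epow s) = s := by
  induction s with
  | nil => rfl
  | cons a s ih =>
    rcases h : epow s with _ | ⟨⟨b, k⟩, r⟩
    · rw [h] at ih; simp [epow, h]; simpa using ih
    · by_cases hab : a = b
      · subst hab
        rw [epow_cons_of_eq h, ← ih, h]; simp [List.replicate_succ]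
      · rw [epow_cons_of_ne h hab, ← ih, h]; simp

theorem length_epow_le (s : List ℕ) : (epow s).length ≤ s.length := by
  induction s with
  | nil => simp
  | cons a s ih =>
    rcases h : epow s with _ | ⟨⟨b, k⟩, r⟩
    · simp [epow, h]
    · by_cases hab : a = b
      · subst hab; rw [epow_cons_of_eq h]; rw [h] at ih; simp at ih ⊢; omega
      · rw [epow_cons_of_ne h hab]; rw [h] at ih; simp at ih ⊢; omega

theorem mem_of_mem_epow {s : List ℕ} {r : ℕ × ℕ} (h : r ∈ epow s) : r.1 ∈ s ∧ 1 ≤ r.2 := by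
  induction s generalizing r with
  | nil => simp at h
  | cons a s ih =>
    rcases h' : epow s with _ | ⟨⟨b, k⟩, q⟩
    · simp [epow, h'] at h; subst h; simp
    · have hb := ih (r := (b, k)) (by simp [h'])
      have hq : ∀ r ∈ q, r.1 ∈ s ∧ 1 ≤ r.2 := fun r hr => ih (by simp [h', hr])
      by_cases hab : a = b
      · subst hab
        rw [epow_cons_of_eq h'] at h
        rcases List.mem_cons.1 h with rfl | h
        · simp
        · simp [hq r h]
      · rw [epow_cons_of_ne h' hab] at h
        rcases List.mem_cons.1 h with rfl | h
        · simp
        · rcases List.mem_cons.1 h with rfl | h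
          · simpa using ⟨Or.inr hb.1, hb.2⟩
          · simp [hq r h]

theorem isChain_epow (s : List ℕ) : (epow s).IsChain (fun r r' => r.1 ≠ r'.1) := by
  induction s with
  | nil => simp
  | cons a s ih =>
    rcases h : epow s with _ | ⟨⟨b, k⟩, r⟩
    · simp [epow, h]
    · rw [h] at ih
      by_cases hab : a = b
      · subst hab; rw [epow_cons_of_eq h]
        rw [List.isChain_cons] at ih ⊢
        exact ih
      · rw [epow_cons_of_ne h hab]
        exact List.isChain_cons_cons.2 ⟨hab, ih⟩

theorem epow_append {A B : List ℕ} (h : ∀ a ∈ A.getLast?, ∀ b ∈ B.head?, a ≠ b) :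
    epow (A ++ B) = epow A ++ epow B := by
  induction A with
  | nil => simp
  | cons a A ih =>
    cases A with
    | nil =>
      cases B with
      | nil => simp
      | cons b B =>
        obtain ⟨k, r, hr⟩ := exists_epow_cons b B
        have hab : a ≠ b := h a (by simp) b (by simp)
        rw [List.singleton_append, epow_cons_of_ne hr hab, hr]; rfl
    | cons a' A =>
      have ih' := ih (by simpa using h)
      obtain ⟨k, r, hr⟩ := exists_epow_cons a' A
      rw [hr] at ih'
      rw [List.cons_append]
      by_cases hab : a = a'
      · subst hab
        rw [epow_cons_of_eq ih', epow_cons_of_eq hr]; rfl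
      · rw [epow_cons_of_ne ih' hab, epow_cons_of_ne hr hab]; rfl

/-- Appending `C` can only lengthen the last run of `X`. `E₂` collects the runs that meet `X`, so it
has no more runs than `X` but may reach into `C`. -/
theorem epow_append_prefix (X C : List ℕ) (hX : X ≠ []) :
    ∃ E₂ E₃, epow (X ++ C) = E₂ ++ E₃ ∧ E₂ ≠ [] ∧ E₂.length ≤ (epow X).length ∧
      X.length ≤ (expand E₂).length := by
  induction X with
  | nil => exact absurd rfl hX
  | cons x X ih =>
    cases X with
    | nil =>
      obtain ⟨k, r, hr⟩ := exists_epow_cons x C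
      exact ⟨[(x, k + 1)], r, hr, by simp, by simp [epow_singleton], by simp⟩
    | cons y X =>
      obtain ⟨E₂, E₃, h1, h2, h3, h4⟩ := ih (by simp)
      obtain ⟨k, r, hr⟩ := exists_epow_cons y (X ++ C)
      obtain ⟨k', r', hr'⟩ := exists_epow_cons y X
      rw [List.cons_append] at h1
      obtain ⟨e, E, rfl⟩ := List.exists_cons_of_ne_nil h2
      rw [h1, List.cons_append] at hr
      obtain ⟨rfl, -⟩ := List.cons.inj hr
      rw [List.cons_append] at h1
      rw [hr'] at h3
      by_cases hxy : x = y
      · subst hxy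
        refine ⟨(x, k + 1 + 1) :: E, E₃, epow_cons_of_eq h1, by simp, ?_, ?_⟩
        · rw [epow_cons_of_eq hr']; simpa using h3
        · simp at h4 ⊢; omega
      · refine ⟨(x, 1) :: (y, k + 1) :: E, E₃, epow_cons_of_ne h1 hxy, by simp, ?_, ?_⟩
        · rw [epow_cons_of_ne hr' hxy]; simpa using h3
        · simp at h4 ⊢; omega

/-- Letters put in front either lengthen the first run of `E₂` or form runs before it. The number of
runs that meet the old part does not change, but they may now begin inside `A`. -/
theorem epow_append_suffix {Y : List ℕ} (A : List ℕ) {E₂ E₃ : List (ℕ × ℕ)}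
    (h : epow Y = E₂ ++ E₃) (hE : E₂ ≠ []) :
    ∃ E₁ E₂', epow (A ++ Y) = E₁ ++ E₂' ++ E₃ ∧ E₂' ≠ [] ∧ E₂'.length = E₂.length ∧
      (expand E₁).length ≤ A.length ∧
      (expand E₁).length + (expand E₂').length = A.length + (expand E₂).length := by
  induction A with
  | nil => exact ⟨[], E₂, by simpa using h, hE, rfl, by simp, by simp⟩
  | cons a A ih =>
    obtain ⟨E₁, E₂', h1, h2, h3, h4, h5⟩ := ih
    rw [List.cons_append]
    rcases E₁ with _ | ⟨⟨b, k⟩, E₁⟩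
    · obtain ⟨⟨b, k⟩, E, rfl⟩ := List.exists_cons_of_ne_nil h2
      by_cases hab : a = b
      · subst hab
        refine ⟨[], (a, k + 1) :: E, epow_cons_of_eq h1, by simp, by simpa using h3, by simp, ?_⟩
        simp at h5 ⊢; omega
      · refine ⟨[(a, 1)], (b, k) :: E, epow_cons_of_ne h1 hab, by simp, h3, by simp, ?_⟩
        simp at h5 ⊢; omega
    · by_cases hab : a = b
      · subst hab
        refine ⟨(a, k + 1) :: E₁, E₂', epow_cons_of_eq h1, h2, h3, ?_, ?_⟩
        · simp at h4 ⊢; omega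
        · simp at h5 ⊢; omega
      · refine ⟨(a, 1) :: (b, k) :: E₁, E₂', epow_cons_of_ne h1 hab, h2, h3, ?_, ?_⟩
        · simp at h4 ⊢; omega
        · simp at h5 ⊢; omega

/-- The runs of a sequence that meet a given part of it. -/
theorem exists_epow_append_append (A X C : List ℕ) (hX : X ≠ []) :
    ∃ E₁ E₂ E₃, epow (A ++ X ++ C) = E₁ ++ E₂ ++ E₃ ∧ E₂.length ≤ (epow X).length ∧
      expand E₁ <+: A ∧ A ++ X <+: expand (E₁ ++ E₂) := by
  obtain ⟨E₂, E₃, h1, h2, h3, h4⟩ := epow_append_prefix X C hX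
  obtain ⟨E₁, E₂', k1, k2, k3, k4, k5⟩ := epow_append_suffix A h1 h2
  have hs := expand_epow (A ++ (X ++ C))
  rw [k1] at hs
  refine ⟨E₁, E₂', E₃, by rw [List.append_assoc, k1], by omega, ?_, ?_⟩
  · apply List.prefix_of_prefix_length_le (l₃ := A ++ (X ++ C)) _ (List.prefix_append _ _) k4
    rw [← hs]; simp
  · apply List.prefix_of_prefix_length_le (l₃ := A ++ (X ++ C))
    · simp
    · rw [← hs]; simp
    · simp; omega

/-! ### Blocks -/

theorem flatten_cut (l : List (ℕ × Bool)) : (cut l).flatten = l.map Prod.fst := by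
  fun_induction cut l <;> simp_all

theorem cut_ne_nil {x : ℕ × Bool} {l : List (ℕ × Bool)} : cut (x :: l) ≠ [] := by
  intro h
  have := flatten_cut (x :: l)
  rw [h] at this
  simp at this

theorem cut_append {A B : List (ℕ × Bool)} (h : ∀ b ∈ B.head?, b.2 = true) :
    cut (A ++ B) = cut A ++ cut B := by
  induction A with
  | nil => simp [cut]
  | cons a A ih =>
    obtain ⟨x, c⟩ := a
    cases A with
    | nil =>
      cases B with
      | nil => simp [cut]
      | cons b B =>
        obtain ⟨y, d⟩ := b
        have : d = true := h (y, d) (by simp)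
        subst this
        simp [cut]
    | cons a' A =>
      obtain ⟨y, d⟩ := a'
      rw [List.cons_append] at ih
      rw [List.cons_append, List.cons_append]
      cases d with
      | true => rw [cut, cut, if_pos rfl, if_pos rfl, ih]; rfl
      | false =>
        rw [cut, cut, if_neg (by simp), if_neg (by simp), ih]
        rcases hq : cut ((y, false) :: A) with _ | ⟨q, qs⟩
        · exact absurd hq cut_ne_nil
        · rfl

theorem map_fst_withBits {W : ℕ} (f : (Fin (logStar W + 11) → ℕ) → Bool) (p : List ℕ) :
    (withBits f p).map Prod.fst = p := by
  rw [withBits, List.map_fst_zip]; simp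

theorem length_withBits {W : ℕ} (f : (Fin (logStar W + 11) → ℕ) → Bool) (p : List ℕ) :
    (withBits f p).length = p.length := by
  simp [withBits]

theorem getElem?_withBits {W : ℕ} (f : (Fin (logStar W + 11) → ℕ) → Bool) (p : List ℕ) (i : ℕ)
    (hi : i < p.length) : (withBits f p)[i]? = some (p[i], bit f p i) := by
  simp [withBits, hi]

theorem flatten_eblock {W : ℕ} (f : (Fin (logStar W + 11) → ℕ) → Bool) (p : List ℕ) :
    (eblock f p).flatten = p := by
  rw [eblock, flatten_cut, map_fst_withBits]

/-! ### `mapM` in `Option` -/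

theorem mapM_eq_some_iff {β γ : Type*} {g : β → Option γ} {l : List β} {r : List γ} :
    l.mapM g = some r ↔ List.Forall₂ (fun a b => g a = some b) l r := by
  induction l generalizing r with
  | nil => simp [eq_comm]
  | cons a l ih =>
    rw [List.mapM_cons]
    constructor
    · intro h
      simp only [Option.bind_eq_bind, Option.bind_eq_some_iff, Option.pure_def,
        Option.some.injEq] at h
      obtain ⟨b, hb, bs, hbs, rfl⟩ := h
      exact List.Forall₂.cons hb (ih.1 hbs)
    · intro h
      cases h with
      | cons hb h => simp [hb, ih.2 h]

theorem mapM_append_eq_some {β γ : Type*} {g : β → Option γ} {l m : List β} {r : List γ}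
    (h : (l ++ m).mapM g = some r) :
    ∃ a b, l.mapM g = some a ∧ m.mapM g = some b ∧ r = a ++ b := by
  rw [List.mapM_append] at h
  simp only [Option.bind_eq_bind, Option.bind_eq_some_iff, Option.pure_def,
        Option.some.injEq] at h
  obtain ⟨a, ha, b, hb, rfl⟩ := h
  exact ⟨a, b, ha, hb, rfl⟩

theorem append_mapM_eq_some {β γ : Type*} {g : β → Option γ} {l m : List β} {a b : List γ}
    (h1 : l.mapM g = some a) (h2 : m.mapM g = some b) : (l ++ m).mapM g = some (a ++ b) := by
  rw [List.mapM_append]; simp [h1, h2]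

theorem length_of_mapM {β γ : Type*} {g : β → Option γ} {l : List β} {r : List γ}
    (h : l.mapM g = some r) : l.length = r.length :=
  (mapM_eq_some_iff.1 h).length_eq

theorem exists_of_mem_mapM {β γ : Type*} {g : β → Option γ} {l : List β} {r : List γ}
    (h : l.mapM g = some r) {b : γ} (hb : b ∈ r) : ∃ a ∈ l, g a = some b := by
  have h := mapM_eq_some_iff.1 h
  induction h with
  | nil => simp at hb
  | cons h1 _ ih =>
    rcases List.mem_cons.1 hb with rfl | hb
    · exact ⟨_, by simp, h1⟩
    · obtain ⟨a, ha, ha'⟩ := ih (by rwa [mapM_eq_some_iff]) hb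
      exact ⟨a, by simp [ha], ha'⟩

theorem exists_of_mem_mapM' {β γ : Type*} {g : β → Option γ} {l : List β} {r : List γ}
    (h : l.mapM g = some r) {a : β} (ha : a ∈ l) : ∃ b ∈ r, g a = some b := by
  have h := mapM_eq_some_iff.1 h
  induction h with
  | nil => simp at ha
  | cons h1 _ ih =>
    rcases List.mem_cons.1 ha with rfl | ha
    · exact ⟨_, by simp, h1⟩
    · obtain ⟨b, hb, hb'⟩ := ih (by rwa [mapM_eq_some_iff]) ha
      exact ⟨b, by simp [hb], hb'⟩

namespace RLSLP

variable {α : Type*} {G : RLSLP α}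

/-! ### Sequences of consecutive nodes -/

/-- The derivation tree of `r` has nodes labelled by the entries of the given sequence that derive
consecutive parts of `val(r)` from the given position on. -/
def NodesAt (G : RLSLP α) (r : ℕ) : ℕ → List ℕ → Prop
  | _, [] => True
  | i, y :: Y => (∃ π, G.label r π = some y ∧ G.offset r π = i) ∧
      NodesAt G r (i + (G.val y).length) Y

theorem nodesAt_append {r i : ℕ} {Y Z : List ℕ} :
    NodesAt G r i (Y ++ Z) ↔ NodesAt G r i Y ∧ NodesAt G r (i + (G.valPlus Y).length) Z := by
  induction Y generalizing i with
  | nil => simp [NodesAt]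
  | cons y Y ih => simp [NodesAt, ih, and_assoc, add_assoc]

theorem NodesAt.of_label {r y i : ℕ} {π : List ℕ} {Z : List ℕ} (hπ : G.label r π = some y)
    (h : NodesAt G y i Z) : NodesAt G r (G.offset r π + i) Z := by
  induction Z generalizing i with
  | nil => trivial
  | cons z Z ih =>
    obtain ⟨⟨σ, h1, h2⟩, h3⟩ := h
    refine ⟨⟨π ++ σ, by rw [label_append hπ, h1], by rw [offset_append hπ, h2]⟩, ?_⟩
    rw [add_assoc]; exact ih h3

/-- The sequence is read off along a cut through the derivation tree of `y`. -/
def Expands (G : RLSLP α) (y : ℕ) (Z : List ℕ) : Prop :=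
  NodesAt G y 0 Z ∧ G.valPlus Z = G.val y

theorem expands_self (y : ℕ) : Expands G y [y] := ⟨⟨⟨[], rfl, rfl⟩, trivial⟩, by simp⟩

theorem expands_children {y : ℕ} (h : G.children y ≠ []) : Expands G y (G.children y) := by
  refine ⟨?_, valPlus_children h⟩
  have key : ∀ (Z A : List ℕ), G.children y = A ++ Z → NodesAt G y (G.valPlus A).length Z := by
    intro Z
    induction Z with
    | nil => intros; trivial
    | cons z Z ih =>
      intro A hA
      have hz : (G.children y)[A.length]? = some z := by simp [hA]
      refine ⟨⟨[A.length], by rw [label_cons hz]; rfl, by rw [offset_cons hz]; simp [hA]⟩, ?_⟩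
      have := ih (A ++ [z]) (by simp [hA])
      simpa using this
  exact key _ [] rfl

theorem NodesAt.flatten {r i : ℕ} {Y : List ℕ} {Zs : List (List ℕ)} (h : NodesAt G r i Y)
    (hZ : List.Forall₂ (fun Z y => Expands G y Z) Zs Y) :
    NodesAt G r i Zs.flatten ∧ G.valPlus Zs.flatten = G.valPlus Y := by
  induction hZ generalizing i with
  | nil => exact ⟨trivial, rfl⟩
  | cons h1 _ ih =>
    obtain ⟨⟨π, h2, h3⟩, h4⟩ := h
    obtain ⟨h5, h6⟩ := ih h4
    rw [List.flatten_cons, nodesAt_append, valPlus_append, h6, h1.2]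
    exact ⟨⟨by have := h1.1.of_label h2; rwa [h3] at this, h5⟩, by simp⟩

theorem Expands.flatten {r : ℕ} {Y : List ℕ} {Zs : List (List ℕ)} (h : Expands G r Y)
    (hZ : List.Forall₂ (fun Z y => Expands G y Z) Zs Y) : Expands G r Zs.flatten := by
  obtain ⟨h1, h2⟩ := h.1.flatten hZ
  exact ⟨h1, h2.trans h.2⟩

theorem expands_pair {x l r : ℕ} (h : G.rhs x = some (.pair l r)) : Expands G x [l, r] := by
  have := expands_children (G := G) (y := x) (by simp [children_of_pair h])
  rwa [children_of_pair h] at this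

theorem expands_pow {x y k : ℕ} (h : G.rhs x = some (.pow y k)) :
    Expands G x (List.replicate k y) := by
  have hk := G.exponent_pos _ _ _ h
  have := expands_children (G := G) (y := x) (by simp [children_of_pow h]; omega)
  rwa [children_of_pow h] at this

theorem rhs_of_sig {x : Rhs α} {e : ℕ} (h : G.sig x = some e) : G.rhs e = some x := by
  unfold sig at h
  split_ifs at h with h'
  cases h
  exact h'.choose_spec

theorem sigBlock_cases {q : List ℕ} {x : ℕ} (h : G.sigBlock q = some x) :
    (∃ a b, q = [a, b] ∧ G.rhs x = some (.pair a b)) ∨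
    (∃ a b c u, q = [a, b, c] ∧ G.rhs u = some (.pair a b) ∧ G.rhs x = some (.pair u c)) ∨
    (∃ a b c d u v, q = [a, b, c, d] ∧ G.rhs u = some (.pair a b) ∧
      G.rhs v = some (.pair u c) ∧ G.rhs x = some (.pair v d)) := by
  match q, h with
  | [a, b], h => exact Or.inl ⟨a, b, rfl, rhs_of_sig h⟩
  | [a, b, c], h =>
    simp only [sigBlock, Option.bind_eq_some_iff] at h
    obtain ⟨u, hu, hx⟩ := h
    exact Or.inr (Or.inl ⟨a, b, c, u, rfl, rhs_of_sig hu, rhs_of_sig hx⟩)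
  | [a, b, c, d], h =>
    simp only [sigBlock, Option.bind_eq_some_iff] at h
    obtain ⟨u, hu, v, hv, hx⟩ := h
    exact Or.inr (Or.inr ⟨a, b, c, d, u, v, rfl, rhs_of_sig hu, rhs_of_sig hv, rhs_of_sig hx⟩)

theorem two_le_length_of_sigBlock {q : List ℕ} {x : ℕ} (h : G.sigBlock q = some x) :
    2 ≤ q.length := by
  rcases sigBlock_cases h with ⟨a, b, rfl, _⟩ | ⟨a, b, c, u, rfl, _⟩ | ⟨a, b, c, d, u, v, rfl, _⟩ <;>
    simp

theorem expands_of_sigBlock {q : List ℕ} {x : ℕ} (h : G.sigBlock q = some x) :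
    Expands G x q := by
  rcases sigBlock_cases h with ⟨a, b, rfl, hx⟩ | ⟨a, b, c, u, rfl, hu, hx⟩ |
    ⟨a, b, c, d, u, v, rfl, hu, hv, hx⟩
  · exact expands_pair hx
  · exact (expands_pair hx).flatten (Zs := [[a, b], [c]])
      (.cons (expands_pair hu) (.cons (expands_self c) .nil))
  · have := (expands_pair hv).flatten (Zs := [[a, b], [c]])
      (.cons (expands_pair hu) (.cons (expands_self c) .nil))
    exact (expands_pair hx).flatten (Zs := [[a, b, c], [d]])
      (.cons this (.cons (expands_self d) .nil))

theorem hasRank_of_sigBlock {q : List ℕ} {x t : ℕ} (h : G.sigBlock q = some x)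
    (hq : ∀ y ∈ q, HasRank G t 4 y) : ∃ c, 1 ≤ c ∧ c ≤ 3 ∧ HasRank G (t + 1) c x := by
  rcases sigBlock_cases h with ⟨a, b, rfl, hx⟩ | ⟨a, b, c, u, rfl, hu, hx⟩ |
    ⟨a, b, c, d, u, v, rfl, hu, hv, hx⟩
  · exact ⟨1, by simp, by simp, .pairBase hx (hq a (by simp)) (hq b (by simp))⟩
  · exact ⟨2, by simp, by simp, .pairStep hx (by simp) (by simp)
      (.pairBase hu (hq a (by simp)) (hq b (by simp))) (hq c (by simp))⟩
  · exact ⟨3, by simp, by simp, .pairStep hx (by simp) (by simp) (.pairStep hv (by simp) (by simp)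
      (.pairBase hu (hq a (by simp)) (hq b (by simp))) (hq c (by simp))) (hq d (by simp))⟩

theorem forall₂_of_sigBlocks {q : List (List ℕ)} {s : List ℕ} (h : G.sigBlocks q = some s) :
    List.Forall₂ (fun Z y => Expands G y Z) q s :=
  (mapM_eq_some_iff.1 h).imp fun _ _ h => expands_of_sigBlock h

theorem forall₂_of_sigRuns {q : List (ℕ × ℕ)} {p : List ℕ} (h : G.sigRuns q = some p) :
    List.Forall₂ (fun Z y => Expands G y Z) (q.map fun r => List.replicate r.2 r.1) p := by
  rw [List.forall₂_map_left_iff]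
  exact (mapM_eq_some_iff.1 h).imp fun _ _ h => expands_pow (rhs_of_sig h)

theorem valPlus_eq_of_forall₂ {Y : List ℕ} {Zs : List (List ℕ)}
    (hZ : List.Forall₂ (fun Z y => Expands G y Z) Zs Y) :
    G.valPlus Zs.flatten = G.valPlus Y := by
  induction hZ with
  | nil => rfl
  | cons h1 _ ih => simp [ih, h1.2]

theorem valPlus_of_sigRuns {q : List (ℕ × ℕ)} {p : List ℕ} (h : G.sigRuns q = some p) :
    G.valPlus p = G.valPlus (expand q) := by
  rw [← valPlus_eq_of_forall₂ (forall₂_of_sigRuns h), expand, List.flatMap]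

theorem valPlus_of_sigBlocks {q : List (List ℕ)} {s : List ℕ} (h : G.sigBlocks q = some s) :
    G.valPlus s = G.valPlus q.flatten :=
  (valPlus_eq_of_forall₂ (forall₂_of_sigBlocks h)).symm

theorem valPlus_of_sigChars {T : List α} {s : List ℕ} (h : G.sigChars T = some s) :
    G.valPlus s = T := by
  have h := mapM_eq_some_iff.1 h
  induction h with
  | nil => rfl
  | cons h1 _ ih =>
    rw [valPlus_cons, ih (by rwa [sigChars, mapM_eq_some_iff]), val_of_char (rhs_of_sig h1)]; rfl

/-! ### The layers of a signature encoding -/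

variable {W : ℕ} {f : (Fin (logStar W + 11) → ℕ) → Bool} {T : List α}

theorem pow_eq_some {t : ℕ} {p : List ℕ} (h : G.pow f T t = some p) :
    ∃ s, G.shrink f T t = some s ∧ G.sigRuns (epow s) = some p := by
  simpa [pow, Option.bind_eq_some_iff] using h

theorem shrink_succ_eq_some {t : ℕ} {s' : List ℕ} (h : G.shrink f T (t + 1) = some s') :
    ∃ s p, G.shrink f T t = some s ∧ G.sigRuns (epow s) = some p ∧ G.pow f T t = some p ∧
      G.sigBlocks (eblock f p) = some s' := by
  simp only [shrink, Option.bind_eq_some_iff] at h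
  obtain ⟨s, hs, p, hp, h⟩ := h
  exact ⟨s, p, hs, hp, by simp [pow, hs, hp], h⟩

theorem hasRank_of_sigRuns {t : ℕ} {s p : List ℕ} (hs : ∀ x ∈ s, ∃ c ≤ 3, HasRank G t c x)
    (h : G.sigRuns (epow s) = some p) : ∀ x ∈ p, HasRank G t 4 x := by
  intro x hx
  obtain ⟨r, hr, hr'⟩ := exists_of_mem_mapM h hx
  obtain ⟨c, hc, hc'⟩ := hs r.1 (mem_of_mem_epow hr).1
  exact .pow (rhs_of_sig hr') hc hc'

theorem hasRank_of_shrink {t : ℕ} {s : List ℕ} (h : G.shrink f T t = some s) :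
    ∀ x ∈ s, ∃ c ≤ 3, HasRank G t c x := by
  induction t generalizing s with
  | zero =>
    intro x hx
    obtain ⟨a, _, ha⟩ := exists_of_mem_mapM h hx
    exact ⟨0, by simp, .char (rhs_of_sig ha)⟩
  | succ t ih =>
    obtain ⟨s', p, h1, h2, _, h3⟩ := shrink_succ_eq_some h
    have hp := hasRank_of_sigRuns (ih h1) h2
    intro x hx
    obtain ⟨q, hq, hq'⟩ := exists_of_mem_mapM h3 hx
    obtain ⟨c, _, hc, hc'⟩ := hasRank_of_sigBlock hq' fun y hy =>
      hp y (by rw [← flatten_eblock f p]; exact List.mem_flatten.2 ⟨q, hq, hy⟩)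
    exact ⟨c, hc, hc'⟩

theorem hasRank_of_pow {t : ℕ} {p : List ℕ} (h : G.pow f T t = some p) :
    ∀ x ∈ p, HasRank G t 4 x := by
  obtain ⟨s, hs, hp⟩ := pow_eq_some h
  exact hasRank_of_sigRuns (hasRank_of_shrink hs) hp

theorem valPlus_of_shrink {t : ℕ} {s : List ℕ} (h : G.shrink f T t = some s) :
    G.valPlus s = T := by
  induction t generalizing s with
  | zero => exact valPlus_of_sigChars h
  | succ t ih =>
    obtain ⟨s', p, h1, h2, _, h3⟩ := shrink_succ_eq_some h
    rw [valPlus_of_sigBlocks h3, flatten_eblock, valPlus_of_sigRuns h2, expand_epow, ih h1]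

theorem valPlus_of_pow {t : ℕ} {p : List ℕ} (h : G.pow f T t = some p) : G.valPlus p = T := by
  obtain ⟨s, hs, hp⟩ := pow_eq_some h
  rw [valPlus_of_sigRuns hp, expand_epow, valPlus_of_shrink hs]

theorem nodesAt_of_sigRuns {r : ℕ} {s p : List ℕ} (h : G.sigRuns (epow s) = some p)
    (hp : NodesAt G r 0 p) : NodesAt G r 0 s := by
  have := (hp.flatten (forall₂_of_sigRuns h)).1
  rwa [← List.flatMap_def, ← expand, expand_epow] at this

/-- All layers up to the given one are defined and consist of consecutive nodes. -/
theorem layers_of_pow {H : ℕ} {p₀ : List ℕ} {r : ℕ} (h : G.pow f T H = some p₀)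
    (hp : NodesAt G r 0 p₀) (t : ℕ) (ht : t ≤ H) :
    ∃ s p, G.shrink f T t = some s ∧ G.pow f T t = some p ∧ G.sigRuns (epow s) = some p ∧
      NodesAt G r 0 s ∧ NodesAt G r 0 p := by
  induction H generalizing p₀ with
  | zero =>
    obtain rfl : t = 0 := by omega
    obtain ⟨s, hs, hsp⟩ := pow_eq_some h
    exact ⟨s, p₀, hs, h, hsp, nodesAt_of_sigRuns hsp hp, hp⟩
  | succ H ih =>
    obtain ⟨s, hs, hsp⟩ := pow_eq_some h
    have hn := nodesAt_of_sigRuns hsp hp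
    rcases Nat.lt_or_ge H t with h' | h'
    · obtain rfl : t = H + 1 := by omega
      exact ⟨s, p₀, hs, h, hsp, hn, hp⟩
    · obtain ⟨s', p, h1, h2, h3, h4⟩ := shrink_succ_eq_some hs
      refine ih h3 ?_ h'
      have := (hn.flatten (forall₂_of_sigBlocks h4)).1
      rwa [flatten_eblock] at this

theorem exists_label_of_mem_vars {x : ℕ} (hx : x ∈ G.vars) :
    ∃ π, G.label G.start π = some x := by
  have := G.not_useless x hx
  clear hx
  induction this with
  | refl => exact ⟨[], rfl⟩
  | @tail y z _ hyz ih =>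
    obtain ⟨π, hπ⟩ := ih
    obtain ⟨i, hi⟩ := List.mem_iff_getElem?.1 hyz
    exact ⟨π ++ [i], by rw [label_append hπ, label_cons (G := G) hi]; rfl⟩

/-! ### Counting runs -/

/-- The nodes of `Q` tile the interval, and a run of the same level that begins inside one of them
overlaps it, so it is that node. -/
theorem countIn_powStarts_le {r t a : ℕ} {Q : List ℕ} (h : NodesAt G r a Q)
    (hQ : ∀ x ∈ Q, HasRank G t 4 x) :
    countIn (powStarts G r t) a (a + (G.valPlus Q).length) ≤ Q.length := by
  induction Q generalizing a with
  | nil => simp [countIn_self]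
  | cons x Q ih =>
    obtain ⟨⟨π, h1, h2⟩, h3⟩ := h
    have h4 := ih h3 fun y hy => hQ y (by simp [hy])
    have h5 := countIn_le_add (powStarts G r t) a (a + (G.val x).length)
      (a + (G.valPlus (x :: Q)).length)
    have h6 : countIn (powStarts G r t) a (a + (G.val x).length) ≤ 1 := by
      rw [← Set.ncard_singleton a]
      refine Set.ncard_le_ncard ?_ (Set.finite_singleton a)
      rintro o ⟨⟨σ, z, k1, k2, rfl⟩, k3, k4⟩
      have := k2.val_pos
      rw [← (hQ x (by simp)).eq_of_overlap k2 h1 k1 (by omega) (by omega)]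
      exact h2
    rw [valPlus_cons, List.length_append, ← add_assoc] at h5 ⊢
    rw [List.length_cons]
    omega

theorem IsPrefix.length_valPlus_le {Y Z : List ℕ} (h : Y <+: Z) :
    (G.valPlus Y).length ≤ (G.valPlus Z).length := by
  obtain ⟨C, rfl⟩ := h
  simp

/-- The runs of the whole layer that meet `X` are at most as many as the runs of `X` itself, and
they cover `X`; the count for tiles is then applied to them. -/
theorem countIn_powStarts_shrink_le {r t : ℕ} {A X C p : List ℕ}
    (h : G.sigRuns (epow (A ++ X ++ C)) = some p) (hp : NodesAt G r 0 p)
    (hr : ∀ x ∈ p, HasRank G t 4 x) :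
    countIn (powStarts G r t) (G.valPlus A).length (G.valPlus (A ++ X)).length ≤
      (epow X).length := by
  rcases eq_or_ne X [] with rfl | hX
  · simp [countIn_self]
  obtain ⟨E₁, E₂, E₃, h1, h2, h3, h4⟩ := exists_epow_append_append A X C hX
  rw [h1] at h
  obtain ⟨a, Q₃, k1, k2, rfl⟩ := mapM_append_eq_some h
  obtain ⟨Q₁, Q₂, k3, k4, rfl⟩ := mapM_append_eq_some k1
  have e1 := IsPrefix.length_valPlus_le (G := G) h3
  have e2 := IsPrefix.length_valPlus_le (G := G) h4
  rw [← valPlus_of_sigRuns k3] at e1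
  rw [← valPlus_of_sigRuns k1, valPlus_append, valPlus_append, List.length_append,
    List.length_append] at e2
  rw [nodesAt_append, nodesAt_append] at hp
  have := countIn_powStarts_le hp.1.2 (fun x hx => hr x (by simp [hx]))
  have h5 := length_of_mapM k4
  refine le_trans (countIn_mono _ (x' := 0 + (G.valPlus Q₁).length)
    (y' := 0 + (G.valPlus Q₁).length + (G.valPlus Q₂).length) (by omega) ?_) (this.trans (by omega))
  rw [valPlus_append, List.length_append]
  omega

end RLSLP
end SigEnc

namespace SigEnc

/-! ### The iterated logarithm -/

/-- By Bernoulli, `log₂ x ≤ n + 1` if `1 < x ≤ n + 2`, so each application lowers an integer bound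
by one. Thus the set in `logStar` is not empty and `sInf` is not the default `0`. -/
theorem exists_iterate_logb_le_one (n : ℕ) (x : ℝ) (hx : x ≤ n + 1) :
    ∃ k, (Real.logb 2)^[k] x ≤ 1 := by
  induction n generalizing x with
  | zero => exact ⟨0, by simpa using hx⟩
  | succ n ih =>
    rcases le_or_gt x 1 with h1 | h1
    · exact ⟨0, h1⟩
    suffices h : Real.logb 2 x ≤ n + 1 by
      obtain ⟨k, hk⟩ := ih _ h
      exact ⟨k + 1, hk⟩
    push_cast at hx
    rw [Real.logb_le_iff_le_rpow (by norm_num) (by linarith)]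
    have h := one_add_mul_self_le_rpow_one_add (s := (1 : ℝ)) (by norm_num) (p := (n : ℝ) + 1)
      (by have := n.cast_nonneg (α := ℝ); linarith)
    have e : (1 : ℝ) + 1 = 2 := by norm_num
    rw [e] at h
    linarith

/-- Allows additive constants to be absorbed into multiples of `log* M`. -/
theorem one_le_logStar {n : ℕ} (hn : 2 ≤ n) : 1 ≤ logStar n := by
  obtain ⟨k, hk⟩ := exists_iterate_logb_le_one n n (by linarith)
  have hmem : logStar n ∈ {k : ℕ | (Real.logb 2)^[k] (n : ℝ) ≤ 1} := Nat.sInf_mem ⟨k, hk⟩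
  rcases Nat.eq_zero_or_pos (logStar n) with h | h
  · rw [h] at hmem
    have h2 : (n : ℝ) ≤ 1 := hmem
    have h3 : (2 : ℝ) ≤ n := by exact_mod_cast hn
    linarith
  · exact h

/-! ### First and last runs -/

theorem length_epow_replicate_le (k a : ℕ) : (epow (List.replicate k a)).length ≤ 1 := by
  cases k with
  | zero => simp
  | succ k =>
    suffices h : epow (List.replicate (k + 1) a) = [(a, k + 1)] by simp [h]
    induction k with
    | zero => rfl
    | succ k ih => rw [List.replicate_succ, epow_cons_of_eq ih]

theorem hatL_spec {s : List ℕ} (hs : s ≠ []) :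
    ∃ a k r, hatL s = List.replicate (k + 1) a ∧ s = hatL s ++ r ∧ ∀ b ∈ r.head?, a ≠ b := by
  obtain ⟨a, s, rfl⟩ := List.exists_cons_of_ne_nil hs
  have h1 : hatL (a :: s) = a :: s.takeWhile fun x => x == a := by simp [hatL]
  refine ⟨a, (s.takeWhile fun x => x == a).length, s.dropWhile fun x => x == a, ?_, ?_, ?_⟩
  · rw [h1, List.replicate_succ]
    congr 1
    rw [List.eq_replicate_iff]
    refine ⟨rfl, fun b hb => ?_⟩
    simpa using List.mem_takeWhile_imp hb
  · rw [h1, List.cons_append, List.takeWhile_append_dropWhile]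
  · intro b hb
    have := List.head?_dropWhile_not (fun x => x == a) s
    rw [Option.mem_def] at hb
    rw [hb] at this
    simp at this
    exact fun h => this h.symm

theorem hatR_spec {s : List ℕ} (hs : s ≠ []) :
    ∃ b k r, hatR s = List.replicate (k + 1) b ∧ s = r ++ hatR s ∧ ∀ a ∈ r.getLast?, a ≠ b := by
  obtain ⟨a, k, r, h1, h2, h3⟩ := hatL_spec (s := s.reverse) (by simpa using hs)
  refine ⟨a, k, r.reverse, by rw [hatR, h1]; simp, ?_, ?_⟩
  · rw [hatR, ← List.reverse_append, ← h2, List.reverse_reverse]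
  · intro b hb
    rw [List.getLast?_reverse] at hb
    exact (h3 b hb).symm

theorem trim_append {β : Type*} (A m B : List β) :
    trim A.length B.length (A ++ m ++ B) = m := by
  unfold trim
  rw [show (A ++ m ++ B).length - B.length = (A ++ m).length by simp; omega, List.take_left,
    List.drop_left]

/-- Removal of the first and the last run. -/
theorem exists_hat_split {s : List ℕ} (hs : 3 ≤ (epow s).length) :
    ∃ m, s = hatL s ++ m ++ hatR s ∧ trim (hatL s).length (hatR s).length s = m ∧
      (∀ a ∈ (hatL s).getLast?, ∀ b ∈ m.head?, a ≠ b) ∧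
      (∀ a ∈ m.getLast?, ∀ b ∈ (hatR s).head?, a ≠ b) ∧
      (epow (hatL s)).length ≤ 1 ∧ (epow (hatR s)).length ≤ 1 ∧
      hatL s ≠ [] ∧ hatR s ≠ [] ∧ m ≠ [] ∧ (epow s).length ≤ (epow m).length + 2 := by
  have hne : s ≠ [] := by rintro rfl; simp at hs
  obtain ⟨a, k, r, h1, h2, h3⟩ := hatL_spec hne
  obtain ⟨b, k', r', h4, h5, h6⟩ := hatR_spec hne
  have eL : (epow (hatL s)).length ≤ 1 := by rw [h1]; exact length_epow_replicate_le _ _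
  have eR : (epow (hatR s)).length ≤ 1 := by rw [h4]; exact length_epow_replicate_le _ _
  have hr : ∀ x ∈ (hatL s).getLast?, ∀ y ∈ r.head?, x ≠ y := by
    intro x hx y hy
    rw [h1, List.getLast?_replicate] at hx
    simp at hx
    subst hx; exact h3 y hy
  have es := epow_append hr
  rw [← h2] at es
  have hr' : ∀ x ∈ r'.getLast?, ∀ y ∈ (hatR s).head?, x ≠ y := by
    intro x hx y hy
    rw [h4, List.head?_replicate] at hy
    simp at hy
    subst hy; exact h6 x hx
  have hlen : 2 ≤ (epow r).length := by
    rw [es, List.length_append] at hs; omega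
  rcases List.append_eq_append_iff.1 (h2.symm.trans h5) with ⟨m, hm1, hm2⟩ | ⟨m, hm1, hm2⟩
  · have hmne : m ≠ [] := by
      rintro rfl
      rw [List.nil_append] at hm2
      rw [hm2] at hlen; omega
    have hm3 : ∀ x ∈ m.getLast?, ∀ y ∈ (hatR s).head?, x ≠ y := by
      intro x hx
      apply hr' x
      rw [hm1, List.getLast?_append]
      rw [Option.mem_def] at hx
      simp [hx]
    have em := epow_append hm3
    rw [← hm2] at em
    have hs' : s = hatL s ++ m ++ hatR s := by
      rw [List.append_assoc, ← hm2]; exact h2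
    refine ⟨m, hs', ?_, ?_, hm3, eL, eR, by simp [h1], by simp [h4], hmne, ?_⟩
    · have := trim_append (hatL s) m (hatR s)
      rwa [← hs'] at this
    · intro x hx y hy
      apply hr x hx y
      rw [hm2, List.head?_append]
      rw [Option.mem_def] at hy
      simp [hy]
    · rw [es, em, List.length_append, List.length_append]; omega
  -- Here the last run would begin inside the first one. Then the rest `r` would consist of a single
  -- letter repeated, against its two runs.
  · exfalso
    rw [h4] at hm2
    have hmem : ∀ x ∈ r, x = b := fun x hx =>
      List.eq_of_mem_replicate (n := k' + 1) (by rw [hm2]; simp [hx])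
    rw [List.eq_replicate_of_mem hmem] at hlen
    have := length_epow_replicate_le r.length b
    omega

/-! ### Bits -/

variable {W : ℕ} {f : (Fin (logStar W + 11) → ℕ) → Bool}

/-- The bits depend on a window only. -/
theorem bit_append_append (A Q C : List ℕ) {k : ℕ} (h1 : deltaL W ≤ k) (h2 : k + 4 < Q.length) :
    bit f (A ++ Q ++ C) (A.length + k) = bit f Q k := by
  unfold bit
  congr 1
  funext j
  have hj := j.isLt
  have hd : deltaL W = logStar W + 6 := rfl
  rw [if_pos (by omega), if_pos (by omega),
    show A.length + k + j.val - deltaL W = A.length + (k + j.val - deltaL W) by omega,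
    List.append_assoc, List.getD_append_right _ _ _ _ (by omega), Nat.add_sub_cancel_left,
    List.getD_append _ _ _ _ (by omega)]

theorem lenL_spec (hf : IsLocallyConsistent W f) {Q : List ℕ}
    (hQ : ∀ x ∈ Q, 1 ≤ x ∧ x ≤ W) (hc : Q.IsChain (· ≠ ·)) (hlen : deltaL W + 12 ≤ Q.length) :
    deltaL W ≤ lenL f Q ∧ lenL f Q ≤ deltaL W + 3 ∧ bit f Q (lenL f Q) = true := by
  have h4 := (hf Q (by omega) hQ hc).2.2.2 (deltaL W) (by omega)
  have key : ∃ l, l ≤ deltaL W + 3 ∧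
      l ∈ {l | deltaL W ≤ l ∧ l < Q.length ∧ bit f Q l = true} := by
    rcases h4 with h | h | h | h
    · exact ⟨_, by omega, le_refl _, by omega, h⟩
    · exact ⟨_, by omega, by omega, by omega, h⟩
    · exact ⟨_, by omega, by omega, by omega, h⟩
    · exact ⟨_, by omega, by omega, by omega, h⟩
  obtain ⟨l, hl, hmem⟩ := key
  obtain ⟨h1, _, h3⟩ := Nat.sInf_mem ⟨l, hmem⟩
  exact ⟨h1, (Nat.sInf_le hmem).trans hl, h3⟩

theorem lenR_spec (hf : IsLocallyConsistent W f) {Q : List ℕ}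
    (hQ : ∀ x ∈ Q, 1 ≤ x ∧ x ≤ W) (hc : Q.IsChain (· ≠ ·)) (hlen : deltaL W + 12 ≤ Q.length) :
    5 ≤ lenR f Q ∧ lenR f Q ≤ 8 ∧ bit f Q (Q.length - lenR f Q) = true := by
  -- The four positions `n - 8, …, n - 5` correspond to suffix lengths `8, …, 5`; the shortest
  -- admissible suffix has length `Δ_R + 1 = 5`.
  have h4 := (hf Q (by omega) hQ hc).2.2.2 (Q.length - 8) (by omega)
  have key : ∃ r, r ≤ 8 ∧
      r ∈ {r | deltaR + 1 ≤ r ∧ r ≤ Q.length ∧ bit f Q (Q.length - r) = true} := by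
    have hd : deltaR = 4 := rfl
    rcases h4 with h | h | h | h
    · exact ⟨8, le_refl _, by omega, by omega, h⟩
    · exact ⟨7, by omega, by omega, by omega, by rwa [show Q.length - 7 = Q.length - 8 + 1 by omega]⟩
    · exact ⟨6, by omega, by omega, by omega, by rwa [show Q.length - 6 = Q.length - 8 + 2 by omega]⟩
    · exact ⟨5, by omega, by omega, by omega, by rwa [show Q.length - 5 = Q.length - 8 + 3 by omega]⟩
  obtain ⟨r, hr, hmem⟩ := key
  obtain ⟨h1, _, h3⟩ := Nat.sInf_mem ⟨r, hmem⟩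
  exact ⟨h1, (Nat.sInf_le hmem).trans hr, h3⟩

/-- The blocks between `L` and `R` are blocks of every sequence that contains the given one. -/
theorem eblock_append_append {Q : List ℕ} (A C : List ℕ) {a b : ℕ} (h1 : deltaL W ≤ a)
    (h2 : 5 ≤ b) (h3 : a + b < Q.length) (ha : bit f Q a = true)
    (hb : bit f Q (Q.length - b) = true) :
    ∃ U V, eblock f (A ++ Q ++ C) = U ++ cut (trim a b (withBits f Q)) ++ V ∧
      U.flatten = A ++ Q.take a ∧
      (cut (trim a b (withBits f Q))).flatten = (Q.take (Q.length - b)).drop a ∧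
      V.flatten = Q.drop (Q.length - b) ++ C := by
  set p := A ++ Q ++ C with hp
  have hpl : p.length = A.length + Q.length + C.length := by simp [hp]; omega
  -- `a ≥ Δ_L` and `b ≥ Δ_R + 1` discard the positions of `Q` whose window leaves `Q`. At the
  -- remaining positions `Q` and the longer sequence have the same bits.
  have hmid : trim a b (withBits f Q) =
      ((withBits f p).take (A.length + (Q.length - b))).drop (A.length + a) := by
    apply List.ext_getElem?
    intro j
    rw [trim, List.getElem?_drop, List.getElem?_drop, List.getElem?_take, List.getElem?_take,
      length_withBits]
    by_cases hj : a + j < Q.length - b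
    · rw [if_pos hj, if_pos (by omega), getElem?_withBits f Q _ (by omega),
        getElem?_withBits f p _ (by omega)]
      have := bit_append_append (f := f) A Q C (k := a + j) (by omega) (by omega)
      rw [← add_assoc] at this
      rw [this]
      congr 2
      simp only [hp]
      rw [List.getElem_append_left (by simp; omega), List.getElem_append_right (by omega)]
      congr 1
      omega
    · rw [if_neg hj, if_neg (by omega)]
  have hsplit : withBits f p = (withBits f p).take (A.length + a) ++ trim a b (withBits f Q) ++
      (withBits f p).drop (A.length + (Q.length - b)) := by
    rw [hmid]
    conv_lhs => rw [← List.take_append_drop (A.length + (Q.length - b)) (withBits f p)]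
    congr 1
    conv_lhs => rw [← List.take_append_drop (A.length + a)
      ((withBits f p).take (A.length + (Q.length - b)))]
    rw [List.take_take, min_eq_left (by omega)]
  have hcut : eblock f p = cut ((withBits f p).take (A.length + a)) ++
      cut (trim a b (withBits f Q)) ++ cut ((withBits f p).drop (A.length + (Q.length - b))) := by
    rw [eblock]
    conv_lhs => rw [hsplit]
    rw [cut_append, cut_append]
    · intro x hx
      rw [trim, List.head?_drop, List.getElem?_take, length_withBits, if_pos (by omega),
        getElem?_withBits f Q _ (by omega)] at hx
      simp at hx
      rw [← hx]; exact ha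
    · intro x hx
      rw [List.head?_drop, getElem?_withBits f p _ (by omega)] at hx
      simp at hx
      rw [← hx]
      simp only
      rw [bit_append_append _ _ _ (by omega) (by omega)]; exact hb
  refine ⟨_, _, hcut, ?_, ?_, ?_⟩
  · rw [flatten_cut, List.map_take, map_fst_withBits, hp, List.append_assoc, List.take_length_add_append,
      List.take_append_of_le_length (by omega)]
  · rw [flatten_cut, trim, List.map_drop, List.map_take, map_fst_withBits, length_withBits]
  · rw [flatten_cut, List.map_drop, map_fst_withBits, hp, List.append_assoc, List.drop_length_add_append,
      List.drop_append_of_le_length (by omega)]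

end SigEnc

namespace SigEnc

/-! ### One round inside the layers of the signature encoding -/

theorem two_mul_length_le_length_flatten {β : Type*} {q : List (List β)}
    (h : ∀ b ∈ q, 2 ≤ b.length) : 2 * q.length ≤ q.flatten.length := by
  induction q with
  | nil => simp
  | cons b q ih =>
    have h1 := h b (by simp)
    have h2 := ih fun b hb => h b (by simp [hb])
    simp only [List.length_cons, List.flatten_cons, List.length_append]
    omega

/-- Only the border runs of `X` can continue into `A` or `C`. Those of `m` are bounded by different
letters inside `X`, so they are runs of every sequence around `X`. -/
theorem epow_hat_split {X m : List ℕ} (A C : List ℕ) (hX : X = hatL X ++ m ++ hatR X)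
    (h1 : ∀ a ∈ (hatL X).getLast?, ∀ b ∈ m.head?, a ≠ b)
    (h2 : ∀ a ∈ m.getLast?, ∀ b ∈ (hatR X).head?, a ≠ b)
    (hL : hatL X ≠ []) (hR : hatR X ≠ []) (hm : m ≠ []) :
    epow (A ++ X ++ C) = epow (A ++ hatL X) ++ epow m ++ epow (hatR X ++ C) := by
  have e : A ++ X ++ C = (A ++ hatL X) ++ (m ++ (hatR X ++ C)) := by
    conv_lhs => rw [hX]
    simp
  rw [e, epow_append (A := A ++ hatL X), epow_append (A := m), List.append_assoc]
  · intro x hx y hy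
    rw [List.head?_append_of_ne_nil _ hR] at hy
    exact h2 x hx y hy
  · intro x hx y hy
    rw [List.getLast?_append_of_ne_nil _ hL] at hx
    rw [List.head?_append_of_ne_nil _ hm] at hy
    exact h1 x hx y hy

namespace RLSLP

theorem countIn_of_le (S : Set ℕ) {x y : ℕ} (h : y ≤ x) : countIn S x y = 0 :=
  Nat.le_zero.1 ((countIn_mono S le_rfl h).trans (countIn_self S x).le)

variable {α : Type*} {G : RLSLP α}

theorem HasRank.mem_vars {t c x : ℕ} (h : HasRank G t c x) : x ∈ G.vars := by
  cases h <;> simp_all [vars]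

/-- Equal signatures have equal right-hand sides, hence runs of the same letter, and neighbouring
runs have different letters. This lets `f` be applied to the remaining runs. -/
theorem isChain_of_sigRuns {q : List (ℕ × ℕ)} {p : List ℕ} (h : G.sigRuns q = some p)
    (hq : q.IsChain fun r r' => r.1 ≠ r'.1) : p.IsChain (· ≠ ·) := by
  have h := mapM_eq_some_iff.1 h
  clear * - h hq
  induction h with
  | nil => simp
  | @cons r x q p h1 h2 ih =>
    cases h2 with
    | nil => simp
    | @cons r' y q p h2 h3 =>
      obtain ⟨h4, h5⟩ := List.isChain_cons_cons.1 hq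
      refine List.isChain_cons_cons.2 ⟨?_, ih h5⟩
      rintro rfl
      have e1 := rhs_of_sig h1
      rw [rhs_of_sig h2] at e1
      exact h4 (Rhs.pow.inj (Option.some.inj e1)).1.symm

variable {M : ℕ} {f : (Fin (logStar M + 11) → ℕ) → Bool} {T : List α}

/-- One round of the construction of the common sequence, inside the layers of a signature
encoding. -/
theorem exists_xshrinkStep (hf : IsLocallyConsistent M f) (hM : ∀ x ∈ G.vars, x ≤ M)
    {A X C p s' : List ℕ} (hr : ∀ x ∈ p, x ∈ G.vars)
    (hp : G.sigRuns (epow (A ++ X ++ C)) = some p) (hs' : G.sigBlocks (eblock f p) = some s')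
    (hX : deltaL M + 14 ≤ (epow X).length) :
    ∃ m PA L Qm R PC A' X' C', X = hatL X ++ m ++ hatR X ∧ p = PA ++ (L ++ Qm ++ R) ++ PC ∧
      s' = A' ++ X' ++ C' ∧ G.xpowStep X = some (L ++ Qm ++ R) ∧
      G.xshrinkStep f (L ++ Qm ++ R) = some X' ∧
      (L ++ Qm ++ R).take (lenL f (L ++ Qm ++ R)) = L ∧
      (L ++ Qm ++ R).drop ((L ++ Qm ++ R).length - lenR f (L ++ Qm ++ R)) = R ∧
      L.length ≤ deltaL M + 3 ∧ R.length ≤ 8 ∧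
      G.valPlus m = G.valPlus (L ++ Qm ++ R) ∧ G.valPlus Qm = G.valPlus X' ∧
      G.valPlus PA = G.valPlus (A ++ hatL X) ∧ G.valPlus A' = G.valPlus (PA ++ L) ∧
      X' ≠ [] ∧ 2 * X'.length ≤ X.length ∧ hatL X ≠ [] ∧
      (epow (hatL X)).length ≤ 1 ∧ (epow (hatR X)).length ≤ 1 := by
  obtain ⟨m, hX1, hX2, hX3, hX4, hX5, hX6, hX7, hX8, hX9, hX10⟩ :=
    exists_hat_split (s := X) (by omega)
  have hep := epow_hat_split A C hX1 hX3 hX4 hX7 hX8 hX9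
  rw [hep] at hp
  obtain ⟨a, PC, hp1, hPC, hpe⟩ := mapM_append_eq_some hp
  obtain ⟨PA, Q, hPA, hQ, rfl⟩ := mapM_append_eq_some hp1
  have hQlen : (epow m).length = Q.length := length_of_mapM hQ
  have hQc := isChain_of_sigRuns hQ (isChain_epow m)
  have hQr : ∀ x ∈ Q, 1 ≤ x ∧ x ≤ M := fun x hx => by
    have := hr x (by simp [hpe, hx])
    exact ⟨G.var_pos x this, hM x this⟩
  obtain ⟨hl1, hl2, hl3⟩ := lenL_spec hf hQr hQc (by omega)
  obtain ⟨hr1, hr2, hr3⟩ := lenR_spec hf hQr hQc (by omega)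
  obtain ⟨U, V, hU1, hU2, hU3, hU4⟩ :=
    eblock_append_append (f := f) PA PC hl1 hr1 (by omega) hl3 hr3
  rw [hpe, hU1] at hs'
  obtain ⟨a', C', hs1, hC', rfl⟩ := mapM_append_eq_some hs'
  obtain ⟨A', X', hA', hX', rfl⟩ := mapM_append_eq_some hs1
  have hQs : Q.take (lenL f Q) ++ (Q.take (Q.length - lenR f Q)).drop (lenL f Q) ++
      Q.drop (Q.length - lenR f Q) = Q := by
    conv_rhs => rw [← List.take_append_drop (Q.length - lenR f Q) Q]
    congr 1
    conv_rhs => rw [← List.take_append_drop (lenL f Q) (Q.take (Q.length - lenR f Q))]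
    rw [List.take_take, min_eq_left (by omega)]
  have hflat := congrArg List.length hU3
  rw [List.length_drop, List.length_take] at hflat
  have hX'len := length_of_mapM hX'
  -- `sigBlock` is undefined on single entries, so every block has at least two; this gives the
  -- factor `2` of each round.
  have htwo := two_mul_length_le_length_flatten (q := cut (trim (lenL f Q) (lenR f Q) (withBits f Q)))
    fun b hb => by
      obtain ⟨x, _, hx⟩ := exists_of_mem_mapM' hX' hb
      exact two_le_length_of_sigBlock hx
  have hml : m.length ≤ X.length := by
    conv_rhs => rw [hX1]
    simp; omega
  have := length_epow_le m
  refine ⟨m, PA, Q.take (lenL f Q), (Q.take (Q.length - lenR f Q)).drop (lenL f Q),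
    Q.drop (Q.length - lenR f Q), PC, A', X', C', hX1, ?_⟩
  rw [hQs]
  refine ⟨hpe, rfl, ?_, hX', rfl, rfl, ?_, ?_, ?_, ?_, ?_, ?_, ?_, ?_, hX7, hX5, hX6⟩
  · rw [xpowStep, hX2]; exact hQ
  · rw [List.length_take]; omega
  · rw [List.length_drop]; omega
  · rw [valPlus_of_sigRuns hQ, expand_epow]
  · rw [valPlus_of_sigBlocks hX', hU3]
  · rw [valPlus_of_sigRuns hPA, expand_epow]
  · rw [valPlus_of_sigBlocks hA', hU2]
  -- Without blocks, all of `Q` would be `L` and `R`, of length at most `(Δ_L + 3) + 8`, but `Q` has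
  -- at least `Δ_L + 12` entries.
  · rintro rfl
    have h0 : cut (trim (lenL f Q) (lenR f Q) (withBits f Q)) = [] := by
      simpa using hX'len
    rw [h0] at hflat
    simp at hflat
    omega
  · omega

/-! ### Entries whose proper ancestors belong to late rounds -/

/-- The node `π` labelled `y` lies below no further nodes of its own round than the run that
contains it. -/
def Anchored (G : RLSLP α) (r y : ℕ) (π : List ℕ) : Prop :=
  ∀ σ c τ z s t' c', π = σ ++ c :: τ → G.label r σ = some z → HasRank G t' c' z →
    RankAbove s t' c' → G.level y ≤ s

/-- Like `NodesAt`, with anchored nodes. -/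
def AnchoredAt (G : RLSLP α) (r : ℕ) : ℕ → List ℕ → Prop
  | _, [] => True
  | i, y :: Y => (∃ π, G.label r π = some y ∧ G.offset r π = i ∧ Anchored G r y π) ∧
      AnchoredAt G r (i + (G.val y).length) Y

theorem anchoredAt_append {r i : ℕ} {Y Z : List ℕ} :
    AnchoredAt G r i (Y ++ Z) ↔
      AnchoredAt G r i Y ∧ AnchoredAt G r (i + (G.valPlus Y).length) Z := by
  induction Y generalizing i with
  | nil => simp [AnchoredAt]
  | cons y Y ih => simp [AnchoredAt, ih, and_assoc, add_assoc]

theorem AnchoredAt.exists_label {r i j x : ℕ} {Y : List ℕ} (h : AnchoredAt G r i Y)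
    (hj : Y[j]? = some x) : ∃ π, G.label r π = some x ∧
      G.offset r π = i + (G.valPlus (Y.take j)).length ∧ Anchored G r x π := by
  obtain ⟨hj', rfl⟩ := List.getElem?_eq_some_iff.1 hj
  rw [← List.take_append_drop j Y, anchoredAt_append] at h
  have h2 := h.2
  rw [List.drop_eq_getElem_cons hj'] at h2
  exact h2.1

/-- Proper ancestors of a run of level `t` have larger rank, and a rank above `(t, 4)` belongs to
round `t` or later. -/
theorem NodesAt.anchoredAt {r i t : ℕ} {Y : List ℕ} (h : NodesAt G r i Y)
    (hY : ∀ y ∈ Y, HasRank G t 4 y) : AnchoredAt G r i Y := by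
  induction Y generalizing i with
  | nil => trivial
  | cons y Y ih =>
    obtain ⟨⟨π, h1, h2⟩, h3⟩ := h
    refine ⟨⟨π, h1, h2, ?_⟩, ih h3 fun z hz => hY z (by simp [hz])⟩
    rintro σ c τ z s t' c' rfl hσ hz hs
    rw [label_append hσ] at h1
    have hy := hY y (by simp)
    obtain ⟨t₁, c₁, h4, h5⟩ := hz.exists_of_label h1
    obtain ⟨rfl, rfl⟩ := hy.rank_unique h4
    rw [hy.level_eq]
    simp only [reduceCtorEq, false_and, false_or] at h5
    rcases hs with hs | hs <;> omega

/-- Rank alone does not suffice for entries of `Shrink_t`: a pair of level `t` may also be a proper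
prefix of a block, with a pair of round `t - 1` as parent. Here the nodes are children of a run of
level `t`, so all proper ancestors are that run or nodes above it. -/
theorem AnchoredAt.of_pow {r i t y b k : ℕ} {π : List ℕ} (hπ : G.label r π = some y)
    (hi : G.offset r π = i) (hy : HasRank G t 4 y) (hb : G.rhs y = some (.pow b k)) :
    AnchoredAt G r i (List.replicate k b) := by
  have key : ∀ m n, n + m = k →
      AnchoredAt G r (i + (G.valPlus (List.replicate n b)).length) (List.replicate m b) := by
    intro m
    induction m with
    | zero => intros; trivial
    | succ m ih =>
      intro n hn
      have hc : (G.children y)[n]? = some b := by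
        rw [children_of_pow hb, List.getElem?_replicate, if_pos (by omega)]
      refine ⟨⟨π ++ [n], by rw [label_append hπ, label_cons hc]; rfl, ?_, ?_⟩, ?_⟩
      · rw [offset_append hπ, offset_cons hc, hi, children_of_pow hb, List.take_replicate,
          min_eq_left (by omega)]
        simp
      · rintro σ c τ z s t' c' hστ hσ hz hs
        have hpre : σ <+: π := by
          have h1 : σ <+: π ++ [n] := ⟨c :: τ, hστ.symm⟩
          refine List.prefix_of_prefix_length_le h1 (List.prefix_append _ _) ?_
          have := congrArg List.length hστ
          simp at this
          omega
        obtain ⟨τ', rfl⟩ := hpre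
        rw [label_append hσ] at hπ
        obtain ⟨t₁, c₁, h4, h5⟩ := hz.exists_of_label hπ
        obtain ⟨rfl, rfl⟩ := hy.rank_unique h4
        rw [← level_of_pow hb, hy.level_eq]
        rcases hs with hs | hs <;> omega
      · have := ih (n + 1) (by omega)
        rw [List.replicate_succ', valPlus_append] at this
        simpa [add_assoc] using this
  have := key k 0 (by omega)
  simpa using this

theorem anchoredAt_of_sigRuns {r t : ℕ} {s p : List ℕ} (h : G.sigRuns (epow s) = some p)
    (hp : NodesAt G r 0 p) (hr : ∀ x ∈ p, HasRank G t 4 x) : AnchoredAt G r 0 s := by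
  suffices key : ∀ (q : List (ℕ × ℕ)) (i : ℕ), G.sigRuns q = some p → NodesAt G r i p →
      AnchoredAt G r i (expand q) by
    have := key _ _ h hp
    rwa [expand_epow] at this
  clear h hp
  intro q i h hp
  have h' := mapM_eq_some_iff.1 h
  clear h
  induction h' generalizing i with
  | nil => trivial
  | @cons a x q p h1 h2 ih =>
    obtain ⟨⟨π, h3, h4⟩, h5⟩ := hp
    have h6 := rhs_of_sig h1
    rw [expand_cons, anchoredAt_append, valPlus_replicate, ← val_of_pow h6]
    exact ⟨.of_pow h3 h4 (hr x (by simp)) h6, ih (fun x hx => hr x (by simp [hx])) _ h5⟩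

/-! ### The invariant of the rounds -/

/-- The state of the construction of the common sequence of `P` after `t` rounds: `l` and `r` are
the parts already found on the left and on the right, and `X` is what remains in the middle. The
occurrence of `P` is at position `i` of the string of the signature encoding. -/
structure State (G : RLSLP α) {M : ℕ} (f : (Fin (logStar M + 11) → ℕ) → Bool) (T : List α)
    (H i : ℕ) (P : List α) (t : ℕ) (l X r : List ℕ) : Prop where
  left : ∃ ls, (List.range t).mapM (G.leftPart f P) = some ls ∧ ls.flatten = l
  right : ∃ rs, (List.range t).reverse.mapM (G.rightPart f P) = some rs ∧ rs.flatten = r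
  le : t ≤ H
  mid : G.xshrink f P t = some X
  mid_ne : X ≠ []
  length_le : 2 ^ t * X.length ≤ P.length
  left_ne : t = 0 ∨ l ≠ []
  shrink : ∃ A C, G.shrink f T t = some (A ++ X ++ C) ∧
    (G.valPlus A).length = i + (G.valPlus l).length
  val : G.valPlus (l ++ X ++ r) = P
  nodes : AnchoredAt G G.start i (l ++ X ++ r)
  -- `Δ_L + 5` is preserved by a round: `L̂` adds `1` and `L` at most `Δ_L + 3`, in all `2 Δ_L + 9`,
  -- and the step to the next level leaves half of this, rounded up. The start at `i + 1` omits a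
  -- run that begins exactly with the occurrence.
  countL : countIn (powStarts G G.start t) (i + 1) (i + (G.valPlus l).length) ≤ deltaL M + 5
  countR : countIn (powStarts G G.start t) (i + (G.valPlus l).length + (G.valPlus X).length)
    (i + P.length) ≤ deltaL M + 5
  -- `l₁` and `r₁` are the outer parts as they were after round `s`; what was added later has level
  -- above `s`.
  split : ∀ s < t, ∃ l₁ l₂ r₁ r₂, l = l₁ ++ l₂ ∧ r = r₂ ++ r₁ ∧
    (∀ x ∈ l₂ ++ r₂, s < G.level x) ∧
    countIn (powStarts G G.start s) (i + 1) (i + (G.valPlus l₁).length) ≤ 2 * deltaL M + 9 ∧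
    countIn (powStarts G G.start s) (i + P.length - (G.valPlus r₁).length) (i + P.length) ≤
      2 * deltaL M + 9

theorem State.zero {H i : ℕ} {P u v : List α} {S : List ℕ} (hS : G.shrink f T 0 = some S)
    (hn : AnchoredAt G G.start 0 S) (hP : P ≠ []) (hT : T = u ++ P ++ v) (hu : u.length = i) :
    ∃ X, State G f T H i P 0 [] X [] := by
  have hS' : (u ++ P ++ v).mapM (fun a => G.sig (.char a)) = some S := by rw [← hT]; exact hS
  obtain ⟨a, C, h1, hC, rfl⟩ := mapM_append_eq_some hS'
  obtain ⟨A, X, hA, hX, rfl⟩ := mapM_append_eq_some h1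
  have hvA : G.valPlus A = u := valPlus_of_sigChars hA
  have hvX : G.valPlus X = P := valPlus_of_sigChars hX
  have hl := length_of_mapM hX
  have hPl := List.length_pos_iff.2 hP
  rw [anchoredAt_append, anchoredAt_append, hvA, hu, zero_add] at hn
  exact ⟨X, ⟨[], by simp⟩, ⟨[], by simp⟩, Nat.zero_le _, hX,
    by rintro rfl; simp at hl; exact hP hl, by simp [hl], Or.inl rfl,
    ⟨A, C, hS, by simp [hvA, hu]⟩, by simp [hvX], by simpa using hn.1.2,
    by rw [countIn_of_le _ (by simp)]; omega,
    by rw [countIn_of_le _ (by simp [hvX])]; omega, by simp⟩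

theorem State.succ (hf : IsLocallyConsistent M f) (hM : ∀ x ∈ G.vars, x ≤ M) {H : ℕ}
    (hH : G.pow f T H = some [G.start]) {i t : ℕ} {P : List α} {l X r : List ℕ}
    (h : State G f T H i P t l X r) (hX : deltaL M + 14 ≤ (epow X).length) :
    ∃ l' X' r', State G f T H i P (t + 1) l' X' r' := by
  have hstart : NodesAt G G.start 0 [G.start] := ⟨⟨[], rfl, rfl⟩, trivial⟩
  obtain ⟨A, C, hs, hA⟩ := h.shrink
  obtain ⟨s, p, hs1, hp1, hp2, -, hpn⟩ := layers_of_pow hH hstart t h.le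
  rw [hs] at hs1
  cases hs1
  have hpr := hasRank_of_pow hp1
  -- At the top layer `Pow_H` is a single run, while the inner runs of `X` alone give at least `Δ_L
  -- + 12`. So another layer exists while `X` is long.
  have hlt : t < H := by
    refine lt_of_le_of_ne h.le ?_
    rintro rfl
    rw [hH] at hp1
    cases hp1
    have e1 := length_of_mapM hp2
    obtain ⟨m, hm1, -, hm3, hm4, -, -, hm5, hm6, hm7, hm8⟩ := exists_hat_split (s := X) (by omega)
    have hep := epow_hat_split A C hm1 hm3 hm4 hm5 hm6 hm7
    rw [hep] at e1
    simp at e1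
    omega
  obtain ⟨s', p', hs'1, hp'1, hp'2, -, hp'n⟩ := layers_of_pow hH hstart (t + 1) hlt
  obtain ⟨s₀, p₀, k1, k2, k3, k4⟩ := shrink_succ_eq_some hs'1
  rw [hp1] at k3
  cases k3
  obtain ⟨m, PA, L, Qm, R, PC, A', X', C', e1, e2, e3, e4, e5, e6, e7, e8, e9, e10, e11, e12, e13,
    e14, e15, e16, e17, e18⟩ :=
    exists_xshrinkStep hf hM (fun x hx => (hpr x hx).mem_vars) hp2 k4 hX
  have hXr := hasRank_of_shrink hs
  have hsn' := anchoredAt_of_sigRuns hp2 hpn hpr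
  rw [anchoredAt_append, anchoredAt_append] at hsn'
  have hXn := hsn'.1.2
  rw [e1, anchoredAt_append, anchoredAt_append] at hXn
  have hpn' := hpn
  rw [e2, nodesAt_append, nodesAt_append, nodesAt_append, nodesAt_append] at hpn'
  obtain ⟨⟨-, ⟨hLn, -⟩, hRn⟩, -⟩ := hpn'
  have hs'n := anchoredAt_of_sigRuns hp'2 hp'n (hasRank_of_pow hp'1)
  rw [e3, anchoredAt_append, anchoredAt_append] at hs'n
  have hX'n := hs'n.1.2
  obtain ⟨⟨hln, -⟩, hrn⟩ := by
    have := h.nodes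
    rw [anchoredAt_append, anchoredAt_append] at this
    exact this
  have d1 := congrArg (fun z => (G.valPlus z).length) e1
  have d10 := congrArg List.length e10
  have d11 := congrArg List.length e11
  have d12 := congrArg List.length e12
  have d13 := congrArg List.length e13
  have dP := congrArg List.length h.val
  simp only [valPlus_append, List.length_append] at d1 d10 d11 d12 d13 dP hrn hLn hRn
  have hLr : ∀ x ∈ L, HasRank G t 4 x := fun x hx => hpr x (by rw [e2]; simp [hx])
  have hRr : ∀ x ∈ R, HasRank G t 4 x := fun x hx => hpr x (by rw [e2]; simp [hx])
  have c1 := countIn_powStarts_le hLn hLr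
  have c2 := countIn_powStarts_le hRn hRr
  have c3 : countIn (powStarts G G.start t) (G.valPlus A).length
      (G.valPlus (A ++ hatL X)).length ≤ 1 := by
    refine (countIn_powStarts_shrink_le (C := m ++ hatR X ++ C) ?_ hpn hpr).trans e17
    rw [← hp2]
    conv_rhs => rw [e1]
    simp
  have c4 : countIn (powStarts G G.start t) (G.valPlus (A ++ hatL X ++ m)).length
      (G.valPlus (A ++ hatL X ++ m ++ hatR X)).length ≤ 1 := by
    refine (countIn_powStarts_shrink_le (C := C) ?_ hpn hpr).trans e18
    rw [← hp2]
    conv_rhs => rw [e1]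
    simp
  simp only [valPlus_append, List.length_append] at c3 c4
  have cL : countIn (powStarts G G.start t) (i + 1)
      (i + (G.valPlus (l ++ (hatL X ++ L))).length) ≤ 2 * deltaL M + 9 := by
    have e : i + (G.valPlus (l ++ (hatL X ++ L))).length =
        0 + (G.valPlus PA).length + (G.valPlus L).length := by
      simp only [valPlus_append, List.length_append]; omega
    rw [e]
    have g1 := countIn_le_add (powStarts G G.start t) (i + 1) (G.valPlus A).length
      (0 + (G.valPlus PA).length + (G.valPlus L).length)
    have g2 := countIn_le_add (powStarts G G.start t) (G.valPlus A).length
      (0 + (G.valPlus PA).length) (0 + (G.valPlus PA).length + (G.valPlus L).length)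
    have g3 := h.countL
    rw [← hA] at g3
    rw [← d12] at c3
    rw [zero_add] at *
    omega
  -- The right side needs only `(Δ_L + 5) + 1 + 8`, which is at most `2 Δ_L + 9` because `Δ_L ≥ 6`.
  have cR : countIn (powStarts G G.start t)
      (i + P.length - (G.valPlus (R ++ hatR X ++ r)).length) (i + P.length) ≤
      2 * deltaL M + 9 := by
    have g1 := countIn_le_add (powStarts G G.start t)
      (i + P.length - (G.valPlus (R ++ hatR X ++ r)).length)
      (i + (G.valPlus l).length + (G.valPlus X).length) (i + P.length)
    have g2 := countIn_le_add (powStarts G G.start t)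
      (i + P.length - (G.valPlus (R ++ hatR X ++ r)).length)
      ((G.valPlus A).length + (G.valPlus (hatL X)).length + (G.valPlus m).length)
      (i + (G.valPlus l).length + (G.valPlus X).length)
    have g3 := h.countR
    rw [show (G.valPlus A).length + (G.valPlus (hatL X)).length + (G.valPlus m).length +
      (G.valPlus (hatR X)).length = i + (G.valPlus l).length + (G.valPlus X).length by omega] at c4
    rw [show 0 + (G.valPlus PA).length + ((G.valPlus L).length + (G.valPlus Qm).length) +
      (G.valPlus R).length = (G.valPlus A).length + (G.valPlus (hatL X)).length +
      (G.valPlus m).length by omega, show 0 + (G.valPlus PA).length +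
      ((G.valPlus L).length + (G.valPlus Qm).length) =
      i + P.length - (G.valPlus (R ++ hatR X ++ r)).length by
        simp only [valPlus_append, List.length_append]; omega] at c2
    have : deltaL M = logStar M + 6 := rfl
    omega
  have hlevel : ∀ x, (x ∈ hatL X ++ L ∨ x ∈ R ++ hatR X) → G.level x = t := by
    have hX3 : ∀ x, x ∈ hatL X ∨ x ∈ hatR X → G.level x = t := by
      intro x hx
      have hx' : x ∈ A ++ X ++ C := by
        rw [e1]; rcases hx with hx | hx <;> simp [hx]
      obtain ⟨c, _, hc⟩ := hXr x hx'
      exact hc.level_eq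
    intro x hx
    simp only [List.mem_append] at hx
    rcases hx with (hx | hx) | (hx | hx)
    · exact hX3 x (Or.inl hx)
    · exact (hLr x hx).level_eq
    · exact (hRr x hx).level_eq
    · exact hX3 x (Or.inr hx)
  refine ⟨l ++ (hatL X ++ L), X', R ++ hatR X ++ r, ?_, ?_, hlt, ?_, e14, ?_, ?_, ?_, ?_, ?_, ?_,
    ?_, ?_⟩
  · obtain ⟨ls, h1, h2⟩ := h.left
    refine ⟨ls ++ [hatL X ++ L], ?_, by simp [h2]⟩
    rw [List.range_succ]
    refine append_mapM_eq_some h1 ?_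
    have e6' : List.take (lenL f (L ++ Qm ++ R)) (L ++ Qm ++ R) = L := e6
    simp only [leftPart, h.mid, e4, Option.bind_some, List.mapM_cons, e6']
    simp
  · obtain ⟨rs, h1, h2⟩ := h.right
    refine ⟨(R ++ hatR X) :: rs, ?_, by simp [h2]⟩
    rw [List.range_succ, List.reverse_append, List.reverse_singleton]
    refine append_mapM_eq_some (a := [R ++ hatR X]) ?_ h1
    have e7' : List.drop ((L ++ Qm ++ R).length - lenR f (L ++ Qm ++ R)) (L ++ Qm ++ R) = R := e7
    simp only [rightPart, h.mid, e4, Option.bind_some, List.mapM_cons, e7']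
    simp
  · simp only [xshrink, h.mid, e4, e5, Option.bind_some]
  · have := h.length_le
    calc 2 ^ (t + 1) * X'.length = 2 ^ t * (2 * X'.length) := by ring
      _ ≤ 2 ^ t * X.length := Nat.mul_le_mul_left _ e15
      _ ≤ _ := this
  · right; simp [e16]
  · refine ⟨A', C', by rw [hs'1, e3], ?_⟩
    simp only [valPlus_append, List.length_append]; omega
  · have := h.val
    conv_rhs at e10 => rw [valPlus_append, valPlus_append, e11]
    have e1' := congrArg G.valPlus e1
    simp only [valPlus_append] at this e1' ⊢
    rw [e10] at e1'
    rw [← this, e1']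
    simp
  · simp only [anchoredAt_append, valPlus_append, List.length_append]
    refine ⟨⟨⟨hln, ?_, ?_⟩, ?_⟩, ⟨?_, ?_⟩, ?_⟩
    · have := hXn.1.1
      rwa [zero_add, hA] at this
    · convert hLn.anchoredAt hLr using 1; omega
    · convert hX'n using 1; omega
    · convert hRn.anchoredAt hRr using 1; omega
    · convert hXn.2 using 1
      simp only [valPlus_append, List.length_append]; omega
    · convert hrn using 1; omega
  -- Halving the `2 Δ_L + 9` starts of level `t` restores the bound `Δ_L + 5` at level `t + 1`.
  · have := powStarts_halving (G := G) G.start t (i + 1)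
      (i + (G.valPlus (l ++ (hatL X ++ L))).length)
    omega
  · have := powStarts_halving (G := G) G.start t
      (i + P.length - (G.valPlus (R ++ hatR X ++ r)).length) (i + P.length)
    rw [show i + (G.valPlus (l ++ (hatL X ++ L))).length + (G.valPlus X').length =
      i + P.length - (G.valPlus (R ++ hatR X ++ r)).length by
        simp only [valPlus_append, List.length_append]; omega]
    omega
  · intro s hst
    rcases Nat.lt_succ_iff_lt_or_eq.1 hst with hst | rfl
    · obtain ⟨l₁, l₂, r₁, r₂, f1, f2, f3, f4, f5⟩ := h.split s hst
      refine ⟨l₁, l₂ ++ (hatL X ++ L), r₁, R ++ hatR X ++ r₂, by rw [f1]; simp, by rw [f2]; simp,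
        ?_, f4, f5⟩
      intro x hx
      have : x ∈ l₂ ++ r₂ ∨ (x ∈ hatL X ++ L ∨ x ∈ R ++ hatR X) := by
        simp only [List.mem_append] at hx ⊢; tauto
      rcases this with hx | hx
      · exact f3 x hx
      · rw [hlevel x hx]; exact hst
    · exact ⟨_, [], _, [], by simp, by simp, by simp, cL, cR⟩

end RLSLP
end SigEnc

namespace SigEnc
namespace RLSLP

variable {α : Type*} {G : RLSLP α}

theorem length_le_length_valPlus {Y : List ℕ} (h : ∀ x ∈ Y, 0 < (G.val x).length) :
    Y.length ≤ (G.valPlus Y).length := by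
  induction Y with
  | nil => simp
  | cons y Y ih =>
    have h1 := h y (by simp)
    have h2 := ih fun x hx => h x (by simp [hx])
    rw [valPlus_cons, List.length_cons, List.length_append]
    omega

variable {M : ℕ} {f : (Fin (logStar M + 11) → ℕ) → Bool} {T : List α}

/-! ### The common sequence -/

theorem exists_state (hf : IsLocallyConsistent M f) (hM : ∀ x ∈ G.vars, x ≤ M) {H i : ℕ}
    (hH : G.pow f T H = some [G.start]) {P u v : List α} (hP : P ≠ []) (hT : T = u ++ P ++ v)
    (hu : u.length = i) (t : ℕ)
    (ht : ∀ s < t, ∀ X, G.xshrink f P s = some X → deltaL M + 14 ≤ (epow X).length) :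
    ∃ l X r, State G f T H i P t l X r := by
  induction t with
  | zero =>
    obtain ⟨s, p, hs, hp1, hp2, hsn, hpn⟩ :=
      layers_of_pow hH (r := G.start) ⟨⟨[], rfl, rfl⟩, trivial⟩ 0 (Nat.zero_le _)
    obtain ⟨X, hX⟩ := State.zero hs (anchoredAt_of_sigRuns hp2 hpn (hasRank_of_pow hp1)) hP hT hu
    exact ⟨_, X, _, hX⟩
  | succ t ih =>
    obtain ⟨l, X, r, h⟩ := ih fun s hs => ht s (by omega)
    exact h.succ hf hM hH (ht t (by omega) X h.mid)

theorem exists_state_hP (hf : IsLocallyConsistent M f) (hM : ∀ x ∈ G.vars, x ≤ M) {H i : ℕ}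
    (hH : G.pow f T H = some [G.start]) {P u v : List α} (hP : P ≠ []) (hT : T = u ++ P ++ v)
    (hu : u.length = i) :
    ∃ l X r, State G f T H i P (G.hP f P) l X r ∧ (epow X).length ≤ deltaL M + 13 ∧
      G.uniq f P = some (l ++ X ++ r) := by
  have hne : ∃ t, t ∈ {t | ∃ s, G.xshrink f P t = some s ∧
      (epow s).length ≤ deltaL M + deltaR + 9} := by
    by_contra hcon
    push Not at hcon
    -- If the middle never became short, `|P|` rounds could be run, against `2 ^ t * |X| ≤ |P|` with
    -- `X` not empty. So `hP` is a true minimum.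
    obtain ⟨l, X, r, h⟩ := exists_state hf hM hH hP hT hu P.length fun s _ X hX => by
      by_contra hlt
      exact hcon s ⟨X, hX, by have : deltaR = 4 := rfl; omega⟩
    have h1 := h.length_le
    have h2 := List.length_pos_iff.2 h.mid_ne
    have h3 := Nat.lt_two_pow_self (n := P.length)
    nlinarith
  obtain ⟨l, X, r, h⟩ := exists_state hf hM hH hP hT hu (G.hP f P) fun s hs X hX => by
    by_contra hlt
    exact Nat.notMem_of_lt_sInf hs ⟨X, hX, by have : deltaR = 4 := rfl; omega⟩
  obtain ⟨s, hs1, hs2⟩ := Nat.sInf_mem hne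
  have hs1' : G.xshrink f P (G.hP f P) = some s := hs1
  rw [h.mid] at hs1'
  cases hs1'
  obtain ⟨ls, hl1, hl2⟩ := h.left
  obtain ⟨rs, hr1, hr2⟩ := h.right
  refine ⟨l, X, r, h, hs2, ?_⟩
  simp only [uniq, hl1, h.mid, hr1, Option.bind_some, hl2, hr2]

/-- The bound for the runs of level `s` that begin inside the part of the occurrence that is
represented by entries of level at most `s`. -/
noncomputable def runBound (G : RLSLP α) (W h i n s : ℕ) : ℕ :=
  if s < h then 2 * deltaL W + 9 else countIn (powStarts G G.start s) (i + 1) (i + n)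

/-- Below level `h` this is the split kept in the invariant. From `h` on the whole sequence serves
as `l₁`, since the occurrence as a whole then has few starts. -/
theorem State.exists_split {H i h : ℕ} {P : List α} {l X r : List ℕ}
    (hs : State G f T H i P h l X r) (s : ℕ) :
    ∃ l₁ m r₁, l ++ X ++ r = l₁ ++ m ++ r₁ ∧ (∀ x ∈ m, s < G.level x) ∧
      countIn (powStarts G G.start s) (i + 1) (i + (G.valPlus l₁).length) ≤
        runBound G M h i P.length s ∧
      countIn (powStarts G G.start s) (i + P.length - (G.valPlus r₁).length) (i + P.length) ≤
        runBound G M h i P.length s := by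
  unfold runBound
  obtain ⟨A, C, hsh, -⟩ := hs.shrink
  rcases lt_or_ge s h with hlt | hge
  · rw [if_pos hlt]
    obtain ⟨l₁, l₂, r₁, r₂, h1, h2, h3, h4, h5⟩ := hs.split s hlt
    refine ⟨l₁, l₂ ++ X ++ r₂, r₁, by rw [h1, h2]; simp, ?_, h4, h5⟩
    intro x hx
    have : x ∈ l₂ ++ r₂ ∨ x ∈ X := by simp only [List.mem_append] at hx ⊢; tauto
    rcases this with hx | hx
    · exact h3 x hx
    · obtain ⟨c, _, hc⟩ := hasRank_of_shrink hsh x (by simp [hx])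
      rwa [hc.level_eq]
  · rw [if_neg (by omega)]
    refine ⟨l ++ X ++ r, [], [], by simp, by simp, by rw [hs.val], ?_⟩
    rw [countIn_of_le _ (by simp)]
    exact Nat.zero_le _

/-- Left part, middle and right part contribute `Δ_L + 5`, `Δ_L + 13` and `Δ_L + 5`. -/
theorem State.countIn_le {H i h : ℕ} {P : List α}
    {l X r : List ℕ} (hs : State G f T H i P h l X r) (hpow : G.pow f T H = some [G.start])
    (hX : (epow X).length ≤ deltaL M + 13) :
    countIn (powStarts G G.start h) (i + 1) (i + P.length) ≤ 3 * deltaL M + 23 := by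
  obtain ⟨A, C, hsh, hA⟩ := hs.shrink
  obtain ⟨s, p, hs1, hp1, hp2, hsn, hpn⟩ :=
    layers_of_pow hpow (r := G.start) ⟨⟨[], rfl, rfl⟩, trivial⟩ h hs.le
  rw [hsh] at hs1
  cases hs1
  have c1 := countIn_powStarts_shrink_le hp2 hpn (hasRank_of_pow hp1)
  have c2 := hs.countL
  have c3 := hs.countR
  rw [valPlus_append, List.length_append, hA] at c1
  have g1 := countIn_le_add (powStarts G G.start h) (i + 1) (i + (G.valPlus l).length)
    (i + P.length)
  have g2 := countIn_le_add (powStarts G G.start h) (i + (G.valPlus l).length)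
    (i + (G.valPlus l).length + (G.valPlus X).length) (i + P.length)
  omega

/-! ### Nodes of the induced subtree -/

/-- The nodes of the subtree induced by `U` that have the rank of a run of level `s` or of a pair of
level `s + 1`. -/
def roundNodes (G : RLSLP α) (e i : ℕ) (U : List ℕ) (s : ℕ) : Set (List ℕ) :=
  {π | π ∈ G.inducedSubtree e i U ∧
    ∃ z t c, G.label e π = some z ∧ HasRank G t c z ∧ RankAbove s t c}

theorem finite_and_ncard_preimage_le {N A B : Set (List ℕ)} {a b : ℕ} (ρ : List ℕ)
    (h : ∀ π ∈ N, ρ ++ π ∈ A ∪ B) (hA : A.Finite ∧ A.ncard ≤ a) (hB : B.Finite ∧ B.ncard ≤ b) :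
    N.Finite ∧ N.ncard ≤ a + b := by
  have hinj : Set.InjOn (fun π => ρ ++ π) N := fun x _ y _ he => List.append_cancel_left he
  have hfin := hA.1.union hB.1
  refine ⟨Set.Finite.of_injOn h hinj hfin, ?_⟩
  have h1 := Set.ncard_le_ncard_of_injOn _ h hinj hfin
  have h2 := Set.ncard_union_le A B
  omega

/-- Every inner node of the induced subtree covers the part of some entry of the sequence. -/
theorem exists_entry_of_mem_inducedSubtree {c₀ t₀ e i : ℕ} {ρ : List ℕ} {U π : List ℕ}
    (hstart : HasRank G t₀ c₀ G.start) (hρ : G.label G.start ρ = some e)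
    (hU : AnchoredAt G G.start (G.offset G.start ρ + i) U)
    (hπ : π ∈ G.inducedSubtree e i U) {z : ℕ} (hz : G.label e π = some z) :
    ∃ (j x : ℕ), U[j]? = some x ∧ 0 < (G.val x).length ∧ G.children z ≠ [] ∧
      (∀ s t c, HasRank G t c z → RankAbove s t c → G.level x ≤ s) ∧
      G.offset G.start (ρ ++ π) ≤
        G.offset G.start ρ + i + (G.valPlus (U.take j)).length ∧
      G.offset G.start ρ + i + (G.valPlus (U.take j)).length + (G.val x).length ≤
        G.offset G.start (ρ ++ π) + (G.val z).length := by
  obtain ⟨j, μ, c, ⟨x, hj, hx, hoff⟩, τ, rfl⟩ := hπ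
  obtain ⟨σ, hσ1, hσ2, hσ3⟩ := hU.exists_label hj
  obtain ⟨t, d, hxr, -⟩ := hstart.exists_of_label hσ1
  have hlab : G.label G.start (ρ ++ (π ++ τ ++ [c])) = some x := by rw [label_append hρ, hx]
  have hoff' : G.offset G.start (ρ ++ (π ++ τ ++ [c])) =
      G.offset G.start ρ + i + (G.valPlus (U.take j)).length := by
    rw [offset_append hρ, hoff, add_assoc]
  have hpos := hxr.val_pos
  -- `RepresentsEntry` fixes only label and position. As a label has one rank, these determine the
  -- node, so any representing node is the anchored one.
  have heq : σ = ρ ++ (π ++ τ ++ [c]) :=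
    hxr.eq_of_overlap hxr hσ1 hlab (by omega) (by omega)
  subst heq
  have hz' : G.label G.start (ρ ++ π) = some z := by rw [label_append hρ, hz]
  have e1 : ρ ++ (π ++ τ ++ [c]) = (ρ ++ π) ++ (τ ++ [c]) := by simp
  obtain ⟨c', τ', hτ⟩ : ∃ c' τ', τ ++ [c] = c' :: τ' :=
    List.exists_cons_of_ne_nil (by simp)
  rw [e1] at hlab hoff' hσ3
  have hxz : G.label z (τ ++ [c]) = some x := by rwa [label_append hz'] at hlab
  refine ⟨j, x, hj, hpos, ?_, ?_, ?_, ?_⟩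
  · rw [hτ] at hxz
    obtain ⟨Y, hY, -⟩ := label_cons_eq_some hxz
    intro h
    simp [h] at hY
  · intro s t c hzr hs
    exact hσ3 _ _ _ _ _ _ _ (by rw [hτ]) hz' hzr hs
  · rw [← hoff', offset_append hz']; omega
  · rw [← hoff', offset_append hz']
    have := offset_add_le hxz
    omega

/-- A node of round `s` covers an entry of level at most `s`. Such an entry is not in `m`, so the
node meets the part of `l₁` or of `r₁`, and at most `κ + 1` nodes of one rank do so on each side.
The `8` is two sides times four ranks. -/
theorem roundNodes_le {c₀ t₀ e i s n κ : ℕ} {ρ : List ℕ} {U l₁ m r₁ : List ℕ}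
    (hstart : HasRank G t₀ c₀ G.start) (hρ : G.label G.start ρ = some e)
    (hU : AnchoredAt G G.start (G.offset G.start ρ + i) U) (hn : (G.valPlus U).length = n)
    (h1 : U = l₁ ++ m ++ r₁) (h2 : ∀ x ∈ m, s < G.level x)
    (h3 : countIn (powStarts G G.start s) (G.offset G.start ρ + i + 1)
      (G.offset G.start ρ + i + (G.valPlus l₁).length) ≤ κ)
    (h4 : countIn (powStarts G G.start s)
      (G.offset G.start ρ + i + n - (G.valPlus r₁).length) (G.offset G.start ρ + i + n) ≤ κ) :
    (roundNodes G e i U s).Finite ∧ (roundNodes G e i U s).ncard ≤ 8 * (κ + 1) := by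
  set o := G.offset G.start ρ + i with ho
  have hlen := congrArg (fun Y => (G.valPlus Y).length) h1
  simp only [valPlus_append, List.length_append] at hlen
  have key : ∀ t c, RankAbove s t c →
      {π | π ∈ G.inducedSubtree e i U ∧ ∃ z, G.label e π = some z ∧ HasRank G t c z}.Finite ∧
      {π | π ∈ G.inducedSubtree e i U ∧ ∃ z, G.label e π = some z ∧ HasRank G t c z}.ncard ≤
        (κ + 1) + (κ + 1) := by
    intro t c hc
    have hA := ncard_nodes_le (r := G.start) (x := o) (y := o + (G.valPlus l₁).length) hc
      {σ | ∃ z, G.label G.start σ = some z ∧ HasRank G t c z ∧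
        o < G.offset G.start σ + (G.val z).length ∧
        G.offset G.start σ < o + (G.valPlus l₁).length} (fun π hπ => hπ)
    have hB := ncard_nodes_le (r := G.start) (x := o + n - (G.valPlus r₁).length) (y := o + n) hc
      {σ | ∃ z, G.label G.start σ = some z ∧ HasRank G t c z ∧
        o + n - (G.valPlus r₁).length < G.offset G.start σ + (G.val z).length ∧
        G.offset G.start σ < o + n} (fun π hπ => hπ)
    refine finite_and_ncard_preimage_le ρ ?_ ⟨hA.1, hA.2.trans (by omega)⟩
      ⟨hB.1, hB.2.trans (Nat.succ_le_succ ((countIn_mono _ (by omega) le_rfl).trans h4))⟩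
    rintro π ⟨hπ, z, hz, hzr⟩
    obtain ⟨j, x, hj, hpos, -, hlev, g1, g2⟩ :=
      exists_entry_of_mem_inducedSubtree hstart hρ hU hπ hz
    rw [← ho] at g1 g2
    have hz' : G.label G.start (ρ ++ π) = some z := by rw [label_append hρ, hz]
    have hxl := hlev s t c hzr hc
    have hjU := valPlus_take_add_le (G := G) hj
    rcases lt_or_ge j l₁.length with hjl | hjl
    · left
      have : (G.valPlus (U.take j)).length + (G.val x).length ≤ (G.valPlus l₁).length := by
        have hj' : l₁[j]? = some x := by
          rw [← hj, h1, List.append_assoc, List.getElem?_append_left hjl]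
        have := valPlus_take_add_le (G := G) hj'
        rwa [h1, List.append_assoc, List.take_append_of_le_length hjl.le]
      exact ⟨z, hz', hzr, by omega, by omega⟩
    · right
      have hjm : (l₁ ++ m).length ≤ j := by
        by_contra hcon
        have hxm : x ∈ m := by
          rw [h1, List.getElem?_append_left (by omega), List.getElem?_append_right hjl] at hj
          exact List.mem_of_getElem? hj
        have := h2 x hxm
        omega
      have : (G.valPlus (l₁ ++ m)).length ≤ (G.valPlus (U.take j)).length := by
        have := valPlus_take_le (G := G) U hjm
        conv_lhs at this => rw [h1, List.take_left]
        exact this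
      rw [valPlus_append, List.length_append] at this
      exact ⟨z, hz', hzr, by omega, by omega⟩
  obtain ⟨f1, b1⟩ := key s 4 (Or.inl ⟨rfl, rfl⟩)
  obtain ⟨f2, b2⟩ := key (s + 1) 1 (Or.inr ⟨rfl, by simp⟩)
  obtain ⟨f3, b3⟩ := key (s + 1) 2 (Or.inr ⟨rfl, by simp⟩)
  obtain ⟨f4, b4⟩ := key (s + 1) 3 (Or.inr ⟨rfl, by simp⟩)
  have hsub : roundNodes G e i U s ⊆
      ({π | π ∈ G.inducedSubtree e i U ∧ ∃ z, G.label e π = some z ∧ HasRank G s 4 z} ∪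
      {π | π ∈ G.inducedSubtree e i U ∧ ∃ z, G.label e π = some z ∧ HasRank G (s + 1) 1 z}) ∪
      ({π | π ∈ G.inducedSubtree e i U ∧ ∃ z, G.label e π = some z ∧ HasRank G (s + 1) 2 z} ∪
      {π | π ∈ G.inducedSubtree e i U ∧ ∃ z, G.label e π = some z ∧ HasRank G (s + 1) 3 z}) := by
    rintro π ⟨hπ, z, t, c, hz, hzr, hs⟩
    rcases hs with ⟨rfl, rfl⟩ | ⟨rfl, hc1, hc2⟩
    · exact Or.inl (Or.inl ⟨hπ, z, hz, hzr⟩)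
    · obtain rfl | rfl | rfl : c = 1 ∨ c = 2 ∨ c = 3 := by omega
      · exact Or.inl (Or.inr ⟨hπ, z, hz, hzr⟩)
      · exact Or.inr (Or.inl ⟨hπ, z, hz, hzr⟩)
      · exact Or.inr (Or.inr ⟨hπ, z, hz, hzr⟩)
  have hfin := (f1.union f2).union (f3.union f4)
  refine ⟨hfin.subset hsub, (Set.ncard_le_ncard hsub hfin).trans ?_⟩
  refine (Set.ncard_union_le _ _).trans ?_
  refine (Nat.add_le_add (Set.ncard_union_le _ _) (Set.ncard_union_le _ _)).trans ?_
  omega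

theorem exists_rankAbove {t c z : ℕ} (h : HasRank G t c z) (hz : G.children z ≠ []) :
    ∃ s, RankAbove s t c ∧ (s = t ∨ s = t - 1) ∧ s ≤ t := by
  cases h with
  | char h => exact absurd (children_of_char h) hz
  | pow => exact ⟨t, Or.inl ⟨rfl, rfl⟩, Or.inl rfl, le_rfl⟩
  | @pairBase _ _ _ t => exact ⟨t, Or.inr ⟨rfl, by simp⟩, Or.inr rfl, by omega⟩
  | @pairStep _ _ _ t => exact ⟨t, Or.inr ⟨rfl, by omega⟩, Or.inr rfl, by omega⟩

theorem finite_and_ncard_le_sum {β : Type*} {N : ℕ → Set β} {b : ℕ → ℕ}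
    (h : ∀ s, (N s).Finite ∧ (N s).ncard ≤ b s) (n : ℕ) :
    {x | ∃ s < n, x ∈ N s}.Finite ∧ {x | ∃ s < n, x ∈ N s}.ncard ≤ ∑ s ∈ Finset.range n, b s := by
  induction n with
  | zero => simp
  | succ n ih =>
    have e : {x | ∃ s < n + 1, x ∈ N s} = {x | ∃ s < n, x ∈ N s} ∪ N n := by
      ext x
      constructor
      · rintro ⟨s, hs, hx⟩
        rcases Nat.lt_succ_iff_lt_or_eq.1 hs with hs | rfl
        · exact Or.inl ⟨s, hs, hx⟩
        · exact Or.inr hx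
      · rintro (⟨s, hs, hx⟩ | hx)
        · exact ⟨s, by omega, hx⟩
        · exact ⟨n, by omega, hx⟩
    rw [e, Finset.sum_range_succ]
    exact ⟨ih.1.union (h n).1, (Set.ncard_union_le _ _).trans (Nat.add_le_add ih.2 (h n).2)⟩

/-! ### Sums of the bounds -/

/-- A geometric series. The term `2 * d n` carries the induction: passing to `n + 1` adds `d n` and
turns `2 * d (n + 1)` into at most `d n + 1`. -/
theorem sum_halving_le {d : ℕ → ℕ} (h : ∀ k, 2 * d (k + 1) ≤ d k + 1) (n : ℕ) :
    ∑ k ∈ Finset.range n, d k + 2 * d n ≤ 2 * d 0 + n := by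
  induction n with
  | zero => simp
  | succ n ih =>
    have := h n
    rw [Finset.sum_range_succ]
    omega

theorem le_of_halving {d : ℕ → ℕ} (h : ∀ k, 2 * d (k + 1) ≤ d k + 1) (n : ℕ) :
    d n ≤ d 0 + 1 := by
  induction n with
  | zero => omega
  | succ n ih =>
    have := h n
    omega

theorem sum_runBound_le (W h i n k : ℕ) :
    ∑ s ∈ Finset.range k, runBound G W h i n s ≤ h * (2 * deltaL W + 9) +
      2 * countIn (powStarts G G.start h) (i + 1) (i + n) + k := by
  -- The range is enlarged so that it splits at `h` whether or not `k` exceeds `h`.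
  have h1 : ∑ s ∈ Finset.range k, runBound G W h i n s ≤
      ∑ s ∈ Finset.range (h + k), runBound G W h i n s :=
    Finset.sum_le_sum_of_subset (Finset.range_mono (by omega))
  have h2 : ∑ s ∈ Finset.range h, runBound G W h i n s = h * (2 * deltaL W + 9) := by
    have e : ∀ s ∈ Finset.range h, runBound G W h i n s = 2 * deltaL W + 9 :=
      fun s hs => if_pos (Finset.mem_range.1 hs)
    rw [Finset.sum_congr rfl e]
    simp
  have h3 := sum_halving_le
    (d := fun k => countIn (powStarts G G.start (h + k)) (i + 1) (i + n))
    (fun k => powStarts_halving _ _ _ _) k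
  have h4 : ∑ s ∈ Finset.range k, runBound G W h i n (h + s) =
      ∑ s ∈ Finset.range k, countIn (powStarts G G.start (h + s)) (i + 1) (i + n) :=
    Finset.sum_congr rfl fun s _ => if_neg (by omega)
  rw [Finset.sum_range_add, h2, h4] at h1
  simp only [add_zero] at h3
  omega

theorem runBound_le {W h i n D : ℕ}
    (hD : countIn (powStarts G G.start h) (i + 1) (i + n) ≤ D) (hW : 2 * deltaL W + 9 ≤ D) (s : ℕ) :
    runBound G W h i n s ≤ D + 1 := by
  unfold runBound
  split_ifs with hs
  · omega
  · have := le_of_halving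
      (d := fun k => countIn (powStarts G G.start (h + k)) (i + 1) (i + n))
      (fun k => powStarts_halving _ _ _ _) (s - h)
    simp only [add_zero] at this
    rw [Nat.add_sub_cancel' (by omega)] at this
    omega

/-- The numerical form of the bound for the whole subtree. -/
theorem total_bound {N a h Δ D ls S n : ℕ} (hN : N ≤ 8 * (a + (h * (2 * Δ + 9) + 2 * D + a)))
    (ha : 2 ^ a ≤ 2 * S) (hS : 2 ≤ S) (hh : 2 ^ h ≤ n) (hls : 1 ≤ ls) (hΔ : Δ = ls + 6)
    (hD : D ≤ 3 * Δ + 23) (hn : n = 1 → D = 0) :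
    (N : ℝ) ≤ 1000 * (Real.logb 2 S + Real.logb 2 n * ls) := by
  have hlog : ∀ {k m : ℕ}, 2 ^ k ≤ m → (k : ℝ) ≤ Real.logb 2 m := by
    intro k m h
    have hm : 0 < m := lt_of_lt_of_le (by positivity) h
    rw [Real.le_logb_iff_rpow_le (by norm_num) (by exact_mod_cast hm), Real.rpow_natCast]
    exact_mod_cast h
  have hSl : (1 : ℝ) ≤ Real.logb 2 S := by
    have := hlog (k := 1) (m := S) (by simpa using hS)
    simpa using this
  -- `a - 1 ≤ log₂ S`, and the missing `1` is absorbed because `S ≥ 2`.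
  have hal : (a : ℝ) ≤ 2 * Real.logb 2 S := by
    rcases Nat.eq_zero_or_pos a with rfl | hpos
    · push_cast; linarith
    · have := hlog (k := a - 1) (m := S) (by
        obtain ⟨b, rfl⟩ := Nat.exists_eq_add_of_lt hpos
        rw [zero_add, pow_succ] at ha
        simpa using by omega)
      rw [Nat.cast_sub (by omega)] at this
      push_cast at this
      linarith
  have hhl := hlog hh
  have hn0 : 0 < n := lt_of_lt_of_le (by positivity) hh
  have hlsR : (1 : ℝ) ≤ ls := by exact_mod_cast hls
  have hD' : (D : ℝ) ≤ Real.logb 2 n * (44 * ls) := by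
    rcases Nat.lt_or_ge n 2 with h2 | h2
    · obtain rfl : n = 1 := by omega
      rw [hn rfl]; simp
    · have h1 : (1 : ℝ) ≤ Real.logb 2 n := by
        have := hlog (k := 1) (m := n) (by simpa using h2)
        simpa using this
      have h3 : (D : ℝ) ≤ 44 * ls := by
        have : D ≤ 44 * ls := by omega
        exact_mod_cast this
      nlinarith
  have hK : ((2 * Δ + 9 : ℕ) : ℝ) ≤ 23 * ls := by
    have : 2 * Δ + 9 ≤ 23 * ls := by omega
    exact_mod_cast this
  have hhK : (h : ℝ) * ((2 * Δ + 9 : ℕ) : ℝ) ≤ Real.logb 2 n * (23 * ls) :=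
    mul_le_mul hhl hK (by positivity) (le_trans (by positivity) hhl)
  have hp : 0 ≤ Real.logb 2 n * ls := by
    have : (0 : ℝ) ≤ Real.logb 2 n := le_trans (by positivity) hhl
    positivity
  have hN' : (N : ℝ) ≤ 8 * (a + (h * ((2 * Δ + 9 : ℕ) : ℝ) + 2 * D + a)) := by exact_mod_cast hN
  nlinarith

end RLSLP
end SigEnc

namespace SigEnc
namespace RLSLP

variable {α : Type*} {G : RLSLP α} {M : ℕ} {f : (Fin (logStar M + 11) → ℕ) → Bool} {T : List α}

/-- The nodes that represent the common sequence lie in the derivation tree of every variable whose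
string contains the occurrence. -/
theorem State.exists_representsEntry {H h e i t₀ c₀ : ℕ} {P u v : List α} {l X r ρ : List ℕ}
    (hstart : HasRank G t₀ c₀ G.start) (hρ : G.label G.start ρ = some e)
    (hs : State G f T H (G.offset G.start ρ + i) P h l X r) (he : G.val e = u ++ P ++ v)
    (hu : u.length = i) {j : ℕ} (hj : j < (l ++ X ++ r).length) :
    ∃ π, G.RepresentsEntry e i (l ++ X ++ r) j π := by
  set U := l ++ X ++ r with hU
  have hx : U[j]? = some U[j] := List.getElem?_eq_getElem hj
  set x := U[j]
  have hn := hs.nodes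
  rw [← hU] at hn
  obtain ⟨σ, hσ1, hσ2, -⟩ := hn.exists_label hx
  obtain ⟨t, c, hxr, -⟩ := hstart.exists_of_label hσ1
  have hpos := hxr.val_pos
  have hUP := congrArg List.length hs.val
  have heP := congrArg List.length he
  simp only [List.length_append] at heP
  have hjx := valPlus_take_add_le (G := G) hx
  rw [← hU] at hUP
  have hnode : ∀ π, ρ ++ π = σ → ∃ π, G.RepresentsEntry e i U j π := by
    rintro π rfl
    rw [label_append hρ] at hσ1
    rw [offset_append hρ, add_assoc] at hσ2
    exact ⟨π, x, hx, hσ1, Nat.add_left_cancel hσ2⟩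
  rcases prefix_or_prefix_of_overlap hρ hσ1 (by omega) (by omega) with ⟨π, hπ⟩ | ⟨τ, hτ⟩
  · exact hnode π hπ
  · rcases eq_or_ne τ [] with rfl | hne
    · exact hnode [] (by simpa using hτ.symm)
    exfalso
    rw [← hτ, label_append hσ1] at hρ
    -- Here the entry would be a proper ancestor of the root of the tree of `e` and would derive all
    -- of `P`. Without rounds the entries are characters, which have no children; otherwise there
    -- are at least two entries, each deriving something, so none derives all of `P`.
    rcases hs.left_ne with h0 | hl
    · subst h0
      obtain ⟨ls, hls, hl⟩ := hs.left
      obtain ⟨rs, hrs, hr⟩ := hs.right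
      simp only [List.range_zero, List.reverse_nil, List.mapM_nil, Option.pure_def,
        Option.some.injEq] at hls hrs
      subst hls hrs hl hr
      have hX : x ∈ X := by
        have := List.mem_of_getElem? hx
        simpa [hU] using this
      obtain ⟨A, C, hsh, -⟩ := hs.shrink
      obtain ⟨c', hc', hxr'⟩ := hasRank_of_shrink hsh x (by simp [hX])
      obtain ⟨k, τ', rfl⟩ := List.exists_cons_of_ne_nil hne
      obtain ⟨Y, hY, -⟩ := label_cons_eq_some hρ
      cases hxr' with
      | char h => simp [children_of_char h] at hY
      | pow => omega
    · have hUr : ∀ y ∈ U, 0 < (G.val y).length := fun y hy => by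
        obtain ⟨k, hk⟩ := List.mem_iff_getElem?.1 hy
        obtain ⟨π, hπ, -⟩ := hn.exists_label hk
        obtain ⟨t', c', h', -⟩ := hstart.exists_of_label hπ
        exact h'.val_pos
      have h1 := length_le_length_valPlus (G := G) (Y := U.take j)
        fun y hy => hUr y (List.mem_of_mem_take hy)
      have h2 := length_le_length_valPlus (G := G) (Y := U.drop (j + 1))
        fun y hy => hUr y (List.mem_of_mem_drop hy)
      have h3 : (G.valPlus U).length = (G.valPlus (U.take j)).length + (G.val x).length +
          (G.valPlus (U.drop (j + 1))).length := by
        rw [valPlus_take_add hx]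
        conv_lhs => rw [← List.take_append_drop (j + 1) U, valPlus_append, List.length_append]
      rw [List.length_take] at h1
      rw [List.length_drop] at h2
      have h4 : 2 ≤ U.length := by
        have := List.length_pos_iff.2 hl
        have := List.length_pos_iff.2 hs.mid_ne
        simp only [hU, List.length_append]; omega
      have h5 := offset_add_le hρ
      omega

end RLSLP
end SigEnc

/-! ### Assembly of the two bounds -/

open SigEnc SigEnc.RLSLP in
theorem mainTheorem5 :
    ∃ C : ℝ, 0 < C ∧
      ∀ (α : Type*) (M : ℕ) (f : (Fin (SigEnc.logStar M + 11) → ℕ) → Bool)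
        (T : List α) (G : SigEnc.RLSLP α),
        SigEnc.IsLocallyConsistent M f → T ≠ [] → 4 * T.length ≤ M →
        G.IsSignatureEncoding M f T →
        ∀ e ∈ G.vars, ∀ u P v : List α, P ≠ [] → G.val e = u ++ P ++ v →
          ∃ U : List ℕ, G.uniq f P = some U ∧ G.Represents e u.length P U ∧
            (G.inducedSubtree e u.length U).Finite ∧
            (∀ t : ℕ, ((G.inducedSubtree e u.length U ∩ G.levelNodes e t).ncard : ℝ) ≤
              C * SigEnc.logStar M) ∧
            (2 ≤ (G.val e).length →
              ((G.inducedSubtree e u.length U).ncard : ℝ) ≤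
                C * (Real.logb 2 (G.val e).length +
                  Real.logb 2 P.length * SigEnc.logStar M)) := by
  refine ⟨1000, by norm_num, ?_⟩
  intro α M f T G hf hT hM hG e he u P v hP hval
  obtain ⟨hvars, H, hH, -⟩ := hG
  have hls : 1 ≤ logStar M := one_le_logStar (by
    have := List.length_pos_iff.2 hT
    omega)
  have hΔ : deltaL M = logStar M + 6 := rfl
  have hstart : HasRank G H 4 G.start := hasRank_of_pow hH _ (by simp)
  -- No variable is useless, so the tree of `e` is a subtree of that of the start symbol, and the
  -- occurrence in `val(e)` becomes one in `T`, shifted by the offset of `ρ`.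
  obtain ⟨ρ, hρ⟩ := exists_label_of_mem_vars he
  obtain ⟨te, ce, her, -⟩ := hstart.exists_of_label hρ
  obtain ⟨u', v', hstr, hu'⟩ := val_eq_append_of_label hρ
  have hTval : T = (u' ++ u) ++ P ++ (v ++ v') := by
    have h := valPlus_of_pow hH
    simp only [valPlus_cons, valPlus_nil, List.append_nil] at h
    rw [← h, hstr, hval]; simp
  obtain ⟨l, X, r, hs, hX, hU⟩ := exists_state_hP hf hvars hH hP hTval
    (i := G.offset G.start ρ + u.length) (by simp [hu'])
  have hnodes := hs.nodes
  have hD := hs.countIn_le hH hX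
  have hlenP : 2 ^ G.hP f P ≤ P.length := by
    have h1 := hs.length_le
    have h2 := List.length_pos_iff.2 hs.mid_ne
    exact (Nat.le_mul_of_pos_right _ h2).trans h1
  have hvalU := hs.val
  have hrep : ∀ j < (l ++ X ++ r).length, ∃ π, G.RepresentsEntry e u.length (l ++ X ++ r) j π :=
    fun j hj => hs.exists_representsEntry hstart hρ hval rfl hj
  have hsplit := hs.exists_split
  set U := l ++ X ++ r
  set h := G.hP f P
  set i := G.offset G.start ρ + u.length
  have hround : ∀ s, (roundNodes G e u.length U s).Finite ∧ (roundNodes G e u.length U s).ncard ≤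
      8 * (runBound G M h i P.length s + 1) := by
    intro s
    obtain ⟨l₁, m, r₁, h1, h2, h3, h4⟩ := hsplit s
    exact roundNodes_le hstart hρ hnodes (by rw [hvalU]) h1 h2 h3 h4
  have hmem : ∀ π ∈ G.inducedSubtree e u.length U, ∀ z, G.label e π = some z →
      ∃ s, π ∈ roundNodes G e u.length U s ∧ (s = G.level z ∨ s = G.level z - 1) ∧ s ≤ te := by
    intro π hπ z hz
    obtain ⟨_, _, _, _, hch, _⟩ := exists_entry_of_mem_inducedSubtree hstart hρ hnodes hπ hz
    obtain ⟨t, c, hzr, hlt⟩ := her.exists_of_label hz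
    obtain ⟨s, h1, h2, h3⟩ := exists_rankAbove hzr hch
    have := her.le_four
    exact ⟨s, ⟨hπ, z, t, c, hz, hzr, h1⟩, by rwa [hzr.level_eq], by omega⟩
  obtain ⟨hfin, hcard⟩ := finite_and_ncard_le_sum hround (te + 1)
  have hsub : G.inducedSubtree e u.length U ⊆
      {π | ∃ s < te + 1, π ∈ roundNodes G e u.length U s} := by
    intro π hπ
    have hπ' := hπ
    obtain ⟨j, μ, c, ⟨x, -, hx, -⟩, τ, rfl⟩ := hπ
    obtain ⟨y, hy, -⟩ := exists_label_of_append hx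
    obtain ⟨z, hz, -⟩ := exists_label_of_append hy
    obtain ⟨s, h1, -, h2⟩ := hmem π hπ' z hz
    exact ⟨s, by omega, h1⟩
  refine ⟨U, hU, ⟨hvalU, hrep⟩, hfin.subset hsub, ?_, ?_⟩
  · intro t
    have hb : ∀ s, runBound G M h i P.length s ≤ 3 * deltaL M + 23 + 1 :=
      runBound_le hD (by omega)
    -- Level `t` contains runs of round `t` and pairs of round `t - 1`; for `t = 0` the truncated
    -- subtraction only repeats round `0`. With `8 (3 Δ_L + 25)` nodes per round, two rounds stay
    -- below `1000 log* M`.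
    have hsub' : G.inducedSubtree e u.length U ∩ G.levelNodes e t ⊆
        roundNodes G e u.length U t ∪ roundNodes G e u.length U (t - 1) := by
      rintro π ⟨hπ, z, hz, rfl⟩
      obtain ⟨s, h1, rfl | rfl, -⟩ := hmem π hπ z hz
      · exact Or.inl h1
      · exact Or.inr h1
    have h1 := Set.ncard_le_ncard hsub' ((hround t).1.union (hround (t - 1)).1)
    have h2 := Set.ncard_union_le (roundNodes G e u.length U t) (roundNodes G e u.length U (t - 1))
    have h3 := (hround t).2
    have h4 := (hround (t - 1)).2
    have h5 := hb t
    have h6 := hb (t - 1)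
    have : (G.inducedSubtree e u.length U ∩ G.levelNodes e t).ncard ≤ 1000 * logStar M := by
      omega
    exact_mod_cast this
  · intro h2
    have h1 := Set.ncard_le_ncard hsub hfin
    have h3 := sum_runBound_le (G := G) M h i P.length (te + 1)
    have h4 : ∑ s ∈ Finset.range (te + 1), 8 * (runBound G M h i P.length s + 1) =
        8 * (∑ s ∈ Finset.range (te + 1), runBound G M h i P.length s + (te + 1)) := by
      rw [← Finset.mul_sum, Finset.sum_add_distrib]; simp
    have h5 := her.two_pow_le
    refine total_bound (a := te + 1) (h := h) (Δ := deltaL M)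
      (D := countIn (powStarts G G.start h) (i + 1) (i + P.length)) ?_ ?_ h2 hlenP hls hΔ hD ?_
    · omega
    · rw [pow_succ]; omega
    -- For `|P| = 1` the term `log₂|P|` vanishes and cannot pay for `D`; but then `[i + 1, i + |P|)`
    -- is empty.
    · intro hn
      rw [hn, countIn_self]
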